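/- Notation. For a meromorphic function $g$ on $\mathbb{C}$ and $r>0$, $m(r,g)=\frac1{2\pi}\int_0^{2\pi}\log^+|g(re^{i\theta})|\,d\theta$ is the proximity function, $N(r,g)=\sum_{0<|z|<r}\nu_g(z)\log\frac{r}{|z|}+\nu_g(0)\log r$ is the counting function, where $\nu_g(z)$ is the multiplicity of the pole of $g$ at $z$ ($0$ if there is none), and $T(r,g)=m(r,g)+N(r,g)$ is the Nevanlinna characteristic. A meromorphic function on $\mathbb{C}$ is transcendental if it is not a rational function. Here $\log^+x=\max(0,\log x)$ for $x>0$ and $\log^+0=0$. Theorem 6.1. Let $n,m,k\ge 0$ be integers, let $I\subset\mathbb{Z}_{\ge0}^{m+1}$ and $J\subset\mathbb{Z}_{\ge0}^{k+1}$ be finite sets of multi-indices, and let $a_\lambda$ ($\lambda\in I$) and $b_\mu$ ($\mu\in J$) be meromorphic functions on $\mathbb{C}$. Put $$P(z,f)=\sum_{\lambda=(i_0,\dots,i_m)\in I}P_\lambda(z,f),\qquad P_\lambda(z,f)=a_\lambda f^{i_0}(f')^{i_1}\cdots(f^{(m)})^{i_m},$$ $$Q(z,f)=\sum_{\mu=(j_0,\dots,j_k)\in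 J}Q_\mu(z,f),\qquad Q_\mu(z,f)=b_\mu f^{j_0}(f')^{j_1}\cdots(f^{(k)})^{j_k}.$$ For $\lambda\in I$ let $d(P_\lambda)=i_0+\cdots+i_m$ be the degree and $w(P_\lambda)=i_1+2i_2+\cdots+mi_m$ the weight of $P_\lambda$; define $d(Q_\mu)$ and $w(Q_\mu)$ for $\mu\in J$ in the same way. Let $f$ be a transcendental meromorphic function on $\mathbb{C}$ that satisfies $$f^nP(z,f)=Q(z,f),$$ and suppose that the total degree $\max_{\mu\in J}d(Q_\mu)$ of $Q(z,f)$ as a polynomial in $f$ and its derivatives is at most $n$. Put $W=\sum_{\lambda\in I}w(P_\lambda)+\sum_{\mu\in J}w(Q_\mu)$. Then there exists $r_0>0$ such that, for all $r,\rho$ with $r_0<r<\rho<\infty$, $$\begin{aligned}m(r,P(z,f))\le{}& W\log^+\!\left(\frac{T(\rho,f)}{r}\,\frac{\rho}{\rho-r}\right)+\sum_{\lambda\in I}m(r,a_\lambda)+\sum_{\mu\in J}m(r,b_\mu)\\&+\sum_{\lambda\in I}d(P_\lambda)\log m!+\sum_{\mu\in J}d(Q_\mu)\log k!+\log^+\mathrm{card}(I)+\log^+\mathrm{card}(J)+5.3078\,W.\end{aligned}$$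 -/

import Mathlib

open Filter Real ValueDistribution

/-- A transcendental meromorphic function on `ℂ`: meromorphic in the whole plane and not a rational
function. Meromorphic functions are identified when they agree off a closed discrete set (their
values at poles and removable singularities carry no meaning). -/
def IsTranscendentalMeromorphic (f : ℂ → ℂ) : Prop :=
  Meromorphic f ∧
    ¬ ∃ p q : Polynomial ℂ, q ≠ 0 ∧ f =ᶠ[codiscrete ℂ] fun z => p.eval z / q.eval z

/-- The degree `i₀ + i₁ + ⋯ + iₘ` of a multi-index `(i₀, …, iₘ)`. -/
def multiDegree {m : ℕ} (l : Fin (m + 1) → ℕ) : ℕ := ∑ j, l j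

/-- The weight `i₁ + 2 i₂ + ⋯ + m iₘ` of a multi-index `(i₀, …, iₘ)`. -/
def multiWeight {m : ℕ} (l : Fin (m + 1) → ℕ) : ℕ := ∑ j : Fin (m + 1), (j : ℕ) * l j

/-- The differential monomial `f^{i₀} (f')^{i₁} ⋯ (f^{(m)})^{iₘ}`. -/
noncomputable def diffMonomial {m : ℕ} (l : Fin (m + 1) → ℕ) (f : ℂ → ℂ) (z : ℂ) : ℂ :=
  ∏ j : Fin (m + 1), iteratedDeriv (j : ℕ) f z ^ l j

/-- The differential polynomial `∑_{l ∈ I} a_l f^{i₀} (f')^{i₁} ⋯ (f^{(m)})^{iₘ}`, where `I` is a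
finite set of multi-indices `l = (i₀, …, iₘ)` and the `a_l` are the coefficient functions. -/
noncomputable def diffPoly {m : ℕ} (I : Finset (Fin (m + 1) → ℕ))
    (a : (Fin (m + 1) → ℕ) → ℂ → ℂ) (f : ℂ → ℂ) (z : ℂ) : ℂ :=
  ∑ l ∈ I, a l z * diffMonomial l f z

/-- The total degree of a differential polynomial with index set `I`: the maximal degree of its
terms (`0` if there are none). -/
def totalDegree {m : ℕ} (I : Finset (Fin (m + 1) → ℕ)) : ℕ := I.sup multiDegree

/-!
The proof combines Clunie's argument with a quantitative lemma on the logarithmic derivative that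
handles all derivatives of `f` by means of a single majorant.

**The lemma on the logarithmic derivative** (`exists_norm_iteratedDeriv_le_exp`). For `r < ρ` there
is a function `U ≥ 0` on the circle `|z| = r` whose mean is at most
`log⁺ (T(ρ) / r * ρ / (ρ - r)) + 5.3078`, such that `|f⁽ᵏ⁾| ≤ k! exp (k U) |f|` off a discrete set,
for every `k`. By induction on `k` (`norm_iteratedDeriv_le_of_logDeriv`) it is enough that the
`j`-th derivative of `f' / f` is at most `j! X ^ (j + 1)` with `X = exp U`, for all `j`. A positive
`k` thus costs the factor `k` in front of `log⁺`, which produces the weights `w` in the theorem.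

To bound `f' / f`, choose a radius `R` half-way between `r` and `ρ` and split off the Blaschke
factors of the zeros and poles of `f` in the disc of radius `R` (`exists_logDeriv_eq_sum`).
* The zero-free part is handled by the differentiated Schwarz formula
  (`exists_re_nonneg_norm_iteratedDeriv_logDeriv_le`): it is bounded by a Poisson integral, the real
  part of a holomorphic function `V`. The mean of `Re V` over the smaller circle is `Re V(0)`, that
  is, `m(R, f) + m(R, 1 / f)`, and Cauchy's estimates give the higher derivatives.
* The polar part is a sum of terms `1 / (z - c)` and reflections. On the circle `|z| = r`, the
  product of `z` with such a sum is a combination of functions with values in the right half-plane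
  (`mul_pole_add_reflection`). For such a function `F`, the number `1 + F` does not vanish, so
  Jensen's formula gives the mean of `log |1 + F|` exactly (`circleAverage_log_norm_one_add`). This
  takes the place of fractional moments (`exists_circleIntegrable_norm_sum_le`).
* The derivatives of the polar part only need the square function of the terms
  (`norm_iteratedDeriv_sum_le`), because the `ℓ²` norm dominates all `ℓʲ` norms with `j ≥ 2`. Its
  logarithmic mean is found term by term (`exists_circleIntegrable_squareSum_le`).

By the First Main Theorem and the growth of `T` (`exists_proximity_logCounting_le`), the means and
the number of zeros and poles are bounded by `T(ρ)`. The parts are normalized such that `64 L` times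
the exponential of their sum is an upper bound for `X`, with `L = T(ρ) / r * ρ / (ρ - r)`; since
`log 64 + 0.96 < 5.3078`, the constant follows.

**Clunie's argument** (`posLog_norm_diffPoly_le`). Where `|f| ≤ 1`, the powers of `f` in each term
of `P` are at most `1`, and where `|f| ≥ 1`, the identity `P = Q / f ^ n` reduces `P` to the terms
of `Q`, in which the powers of `f` are at most `|f| ^ n`. In both cases `log⁺ |P|` is bounded by the
sum of the bounds for `P` and `Q`, and averaging over the circle gives the theorem.
-/

section

open Complex Metric Set MeromorphicOn Topology
open scoped ComplexConjugate

/-! ### Averages of logarithms and derivatives of all orders -/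

/-- Pointwise inequalities that hold off a discrete subset of a circle may be averaged. -/
theorem circleAverage_mono_of_eventually {F G : ℂ → ℝ} {c : ℂ} {r : ℝ} (hr : r ≠ 0)
    (hF : CircleIntegrable F c r) (hG : CircleIntegrable G c r)
    (h : ∀ᶠ z in codiscreteWithin (sphere c |r|), F z ≤ G z) :
    circleAverage F c r ≤ circleAverage G c r := by
  have hFG : F =ᶠ[codiscreteWithin (sphere c |r|)] fun z => min (F z) (G z) := by
    filter_upwards [h] with z hz using (min_eq_left hz).symm
  rw [circleAverage_congr_codiscreteWithin hFG hr]
  exact circleAverage_mono (hF.congr_codiscreteWithin hFG) hG fun z _ => min_le_right _ _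

theorem one_le_norm_one_add {w : ℂ} (hw : 0 ≤ w.re) : 1 ≤ ‖1 + w‖ := by
  have h := Complex.re_le_norm (1 + w)
  simp only [Complex.add_re, Complex.one_re] at h
  linarith

theorem one_add_sq_norm_le {w : ℂ} (hw : 0 ≤ w.re) : 1 + ‖w‖ ^ 2 ≤ ‖1 + w‖ ^ 2 := by
  rw [← Complex.normSq_eq_norm_sq, ← Complex.normSq_eq_norm_sq, Complex.normSq_apply,
    Complex.normSq_apply]
  simp only [Complex.add_re, Complex.one_re, Complex.add_im, Complex.one_im]
  nlinarith

theorem norm_le_norm_one_add {w : ℂ} (hw : 0 ≤ w.re) : ‖w‖ ≤ ‖1 + w‖ := by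
  have := one_add_sq_norm_le hw
  exact le_of_sq_le_sq (by linarith) (norm_nonneg _)

/-- A function with nonnegative real part, holomorphic in a disc, satisfies the mean value
property in the form `avg log |1 + F| = log |1 + F 0|`, even if it has poles on the circle. -/
theorem circleAverage_log_norm_one_add {F : ℂ → ℂ} {r : ℝ} (hr : 0 < r)
    (hF : MeromorphicOn F (closedBall 0 r)) (hFa : ∀ z ∈ ball (0 : ℂ) r, AnalyticAt ℂ F z)
    (hre : ∀ z ∈ ball (0 : ℂ) r, 0 ≤ (F z).re) :
    circleAverage (fun z => Real.log ‖1 + F z‖) 0 r = Real.log ‖1 + F 0‖ := by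
  have hne : ∀ z ∈ ball (0 : ℂ) r, 1 + F z ≠ 0 := fun z hz h0 => by
    have := one_le_norm_one_add (hre z hz)
    rw [h0, norm_zero] at this
    linarith
  have han : ∀ z ∈ ball (0 : ℂ) r, AnalyticAt ℂ (fun z => 1 + F z) z := fun z hz =>
    analyticAt_const.add (hFa z hz)
  have hmer : MeromorphicOn (fun z => 1 + F z) (closedBall 0 |r|) := by
    rw [abs_of_pos hr]
    exact (MeromorphicOn.const 1).add hF
  have h0 : (0 : ℂ) ∈ ball (0 : ℂ) r := mem_ball_self hr
  have hdiv : ∀ u ∈ ball (0 : ℂ) r, divisor (fun z => 1 + F z) (closedBall 0 |r|) u = 0 := by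
    intro u hu
    rw [divisor_apply hmer (by rw [abs_of_pos hr]; exact ball_subset_closedBall hu),
      (han u hu).meromorphicNFAt.meromorphicOrderAt_eq_zero_iff.2 (hne u hu)]
    rfl
  rw [MeromorphicOn.circleAverage_log_norm hr.ne' hmer, hdiv 0 h0,
    (han 0 h0).meromorphicTrailingCoeffAt_of_ne_zero (hne 0 h0), finsum_eq_zero_of_forall_eq_zero]
  · simp
  · intro u
    rcases lt_trichotomy ‖u‖ r with h | h | h
    · rw [hdiv u (by simpa using h)]; simp
    · simp [h, hr.ne']
    · rw [Function.locallyFinsuppWithin.apply_eq_zero_of_notMem _ (by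
        rw [abs_of_pos hr]; simpa using h)]
      simp

theorem circleIntegrable_log_norm_one_add {F : ℂ → ℂ} {r : ℝ} (hr : 0 < r)
    (hF : MeromorphicOn F (closedBall 0 r)) :
    CircleIntegrable (fun z => Real.log ‖1 + F z‖) 0 r := by
  apply MeromorphicOn.circleIntegrable_log_norm
  refine ((MeromorphicOn.const 1).add hF).mono_set ?_
  rw [abs_of_pos hr]
  exact sphere_subset_closedBall

/-- If all derivatives of the logarithmic derivative of `f` are dominated by those of
`X / (1 - X t)`, then the derivatives of `f` are dominated by those of `|f z| / (1 - X t)`. -/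
theorem norm_iteratedDeriv_le_of_logDeriv {f : ℂ → ℂ} {z : ℂ} {X : ℝ} (hX : 0 ≤ X)
    (hf : AnalyticAt ℂ f z) (hfz : f z ≠ 0)
    (h : ∀ j : ℕ, ‖iteratedDeriv j (logDeriv f) z‖ ≤ j.factorial * X ^ (j + 1)) (k : ℕ) :
    ‖iteratedDeriv k f z‖ ≤ k.factorial * X ^ k * ‖f z‖ := by
  induction k using Nat.strong_induction_on with
  | _ k ih =>
  rcases k with _ | k
  · simp
  have hev : deriv f =ᶠ[𝓝 z] logDeriv f * f := by
    filter_upwards [hf.continuousAt.eventually_ne hfz] with w hw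
    simp [logDeriv_apply, div_mul_cancel₀ _ hw]
  have hld : AnalyticAt ℂ (logDeriv f) z := hf.deriv.div hf hfz
  rw [iteratedDeriv_succ', hev.iteratedDeriv_eq, iteratedDeriv_mul hld.contDiffAt hf.contDiffAt]
  have hterm : ∀ i ∈ Finset.range (k + 1),
      ‖(k.choose i : ℂ) * iteratedDeriv i (logDeriv f) z * iteratedDeriv (k - i) f z‖ ≤
        k.factorial * X ^ (k + 1) * ‖f z‖ := by
    intro i hi
    have hik : i ≤ k := Nat.lt_succ_iff.1 (Finset.mem_range.1 hi)
    rw [norm_mul, norm_mul, Complex.norm_natCast]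
    calc (k.choose i : ℝ) * ‖iteratedDeriv i (logDeriv f) z‖ * ‖iteratedDeriv (k - i) f z‖
        ≤ k.choose i * (i.factorial * X ^ (i + 1)) *
            ((k - i).factorial * X ^ (k - i) * ‖f z‖) := by
          gcongr
          · exact h i
          · exact ih (k - i) (by omega)
      _ = ((k.choose i * i.factorial * (k - i).factorial : ℕ) : ℝ) *
            (X ^ (i + 1) * X ^ (k - i)) * ‖f z‖ := by push_cast; ring
      _ = k.factorial * X ^ (k + 1) * ‖f z‖ := by
          rw [Nat.choose_mul_factorial_mul_factorial hik, ← pow_add]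
          congr 3
          omega
  calc _ ≤ ∑ i ∈ Finset.range (k + 1), _ := norm_sum_le _ _
    _ ≤ ∑ i ∈ Finset.range (k + 1), k.factorial * X ^ (k + 1) * ‖f z‖ := Finset.sum_le_sum hterm
    _ = _ := by
      rw [Finset.sum_const, Finset.card_range, nsmul_eq_mul, Nat.factorial_succ]
      push_cast; ring

/-! ### The Schwarz formula and zero-free functions -/

theorem circleIntegrable_ofReal {u : ℂ → ℝ} {R : ℝ} (hu : CircleIntegrable u 0 R) :
    CircleIntegrable (fun ζ => (u ζ : ℂ)) 0 R := by
  simp only [CircleIntegrable, intervalIntegrable_iff] at hu ⊢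
  exact Complex.ofRealCLM.integrable_comp hu

theorem norm_circleAverage_le {E : Type*} [NormedAddCommGroup E] [NormedSpace ℝ E] {u : ℂ → E}
    {v : ℂ → ℝ} {R : ℝ} (hv : CircleIntegrable v 0 R) (h : ∀ ζ ∈ sphere (0 : ℂ) |R|, ‖u ζ‖ ≤ v ζ) :
    ‖circleAverage u 0 R‖ ≤ circleAverage v 0 R := by
  rw [circleAverage_def, circleAverage_def, norm_smul, smul_eq_mul, Real.norm_eq_abs,
    abs_of_pos (by positivity)]
  gcongr
  refine intervalIntegral.norm_integral_le_of_norm_le (by positivity) ?_ hv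
  exact Filter.Eventually.of_forall fun θ _ => h _ (circleMap_mem_sphere' 0 R θ)

theorem continuousOn_log_norm {h : ℂ → ℂ} {R : ℝ} (hR : 0 < R)
    (hh : AnalyticOnNhd ℂ h (closedBall 0 R)) (hne : ∀ z ∈ closedBall 0 R, h z ≠ 0) :
    ContinuousOn (fun ζ => Real.log ‖h ζ‖) (sphere 0 |R|) := by
  rw [abs_of_pos hR]
  intro x hx
  have hx' := sphere_subset_closedBall hx
  exact ((hh x hx').continuousAt.norm.log (norm_ne_zero_iff.2 (hne x hx'))).continuousWithinAt

/-- **Schwarz formula**, differentiated: the logarithmic derivative of a zero-free function is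
recovered from the boundary values of `log |h|`. -/
theorem logDeriv_eq_circleAverage {h : ℂ → ℂ} {R : ℝ}
    (hh : AnalyticOnNhd ℂ h (closedBall 0 R)) (hne : ∀ z ∈ closedBall 0 R, h z ≠ 0) {w : ℂ}
    (hw : w ∈ ball 0 R) :
    logDeriv h w =
      circleAverage (fun ζ => (2 * ζ / (ζ - w) ^ 2) • ((Real.log ‖h ζ‖ : ℝ) : ℂ)) 0 R := by
  have hR : 0 < R := pos_of_mem_ball hw
  have hharm : InnerProductSpace.HarmonicOnNhd (fun ζ => Real.log ‖h ζ‖) (closedBall 0 R) :=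
    fun x hx => (hh x hx).harmonicAt_log_norm (hne x hx)
  have hint : CircleIntegrable (fun ζ => Real.log ‖h ζ‖) 0 R :=
    (continuousOn_log_norm hR hh hne).circleIntegrable'
  have hintC := circleIntegrable_ofReal hint
  set S : ℂ → ℂ := fun w =>
    circleAverage (fun ζ => herglotzRieszKernel 0 w ζ • ((Real.log ‖h ζ‖ : ℝ) : ℂ)) 0 R with hS
  have hSre : ∀ v ∈ ball (0 : ℂ) R, (S v).re = Real.log ‖h v‖ := by
    intro v hv
    rw [← hharm.circleAverage_re_herglotzRieszKernel_smul hv,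
      re_circleAverage_herglotzRieszKernel_smul hint hv]
  have hSan : AnalyticOnNhd ℂ S (ball 0 R) :=
    analyticOnNhd_circleAverage_herglotzRieszKernel_smul hintC
  -- `h * exp (-S)` has modulus `1`, so it is constant and `h' / h = S'`.
  set q : ℂ → ℂ := fun v => h v * Complex.exp (-S v) with hq
  have hqan : AnalyticOnNhd ℂ q (ball 0 R) := fun v hv =>
    (hh v (ball_subset_closedBall hv)).mul (hSan v hv).neg.cexp
  have hqn : ∀ v ∈ ball (0 : ℂ) R, ‖q v‖ = 1 := by
    intro v hv
    have hv0 := norm_pos_iff.2 (hne v (ball_subset_closedBall hv))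
    rw [hq, norm_mul, Complex.norm_exp, Complex.neg_re, hSre v hv, Real.exp_neg,
      Real.exp_log hv0, mul_inv_cancel₀ hv0.ne']
  have hqc : EqOn q (Function.const ℂ (q w)) (ball 0 R) :=
    Complex.eqOn_of_isPreconnected_of_isMaxOn_norm (convex_ball 0 R).isPreconnected isOpen_ball
      hqan.differentiableOn hw (fun v hv => by simp [hqn v hv, hqn w hw])
  have hder0 : deriv q w = 0 := by
    have : q =ᶠ[𝓝 w] fun _ => q w := by
      filter_upwards [isOpen_ball.mem_nhds hw] with v hv using hqc hv
    rw [this.deriv_eq, deriv_const]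
  have hSd := hasDerivAt_circleAverage_herglotzRieszKernel_smul hintC hw
  have hhd := (hh w (ball_subset_closedBall hw)).differentiableAt.hasDerivAt
  have hqd := (hhd.mul hSd.neg.cexp).deriv
  have hqd' : deriv q w = _ := hqd
  rw [hder0] at hqd'
  have hexp := Complex.exp_ne_zero (-S w)
  have hw0 := hne w (ball_subset_closedBall hw)
  rw [logDeriv_apply, div_eq_iff hw0]
  apply mul_right_cancel₀ hexp
  simp only [hS, Pi.neg_apply] at hqd' ⊢
  linear_combination -hqd'

/-- The logarithmic derivative of a zero-free function `h` is bounded by the Poisson integral of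
`|log |h||`, which is the real part of a holomorphic function `V`. The bound holds uniformly on
discs about `z`, because the Schwarz kernel varies little there; Cauchy's estimates can therefore
be applied to it. -/
theorem exists_re_nonneg_norm_logDeriv_le {h : ℂ → ℂ} {R : ℝ} (hR : 0 < R)
    (hh : AnalyticOnNhd ℂ h (closedBall 0 R)) (hne : ∀ z ∈ closedBall 0 R, h z ≠ 0) :
    ∃ V : ℂ → ℂ, AnalyticOnNhd ℂ V (ball 0 R) ∧ (∀ z ∈ ball (0 : ℂ) R, 0 ≤ (V z).re) ∧
      (V 0).re = circleAverage (fun ζ => |Real.log ‖h ζ‖|) 0 R ∧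
      ∀ z ∈ ball (0 : ℂ) R, ∀ δ : ℝ, 0 ≤ δ → δ < 1 → ∀ w, ‖w - z‖ ≤ δ * (R - ‖z‖) →
        ‖logDeriv h w‖ ≤ ((1 - δ) ^ 2)⁻¹ * (2 * R / (R ^ 2 - ‖z‖ ^ 2) * (V z).re) := by
  have hcont : ContinuousOn (fun ζ => |Real.log ‖h ζ‖|) (sphere 0 |R|) :=
    (continuousOn_log_norm hR hh hne).abs
  have hint : CircleIntegrable (fun ζ => |Real.log ‖h ζ‖|) 0 R := hcont.circleIntegrable'
  have hre := fun (w : ℂ) (hw : w ∈ ball (0 : ℂ) R) =>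
    re_circleAverage_herglotzRieszKernel_smul hint hw
  have hker : ∀ z ∈ ball (0 : ℂ) R, ∀ ζ ∈ sphere (0 : ℂ) |R|,
      (herglotzRieszKernel 0 z ζ).re = (R ^ 2 - ‖z‖ ^ 2) / ‖ζ - z‖ ^ 2 := by
    intro z _ ζ hζ
    have h1 := congrFun (poissonKernel_eq_re_herglotzRieszKernel (c := 0) (w := z)) ζ
    have h2 : ‖ζ‖ = R := by simpa [abs_of_pos hR] using hζ
    rw [Function.comp_apply] at h1
    rw [← h1, poissonKernel_def, sub_zero, sub_zero, h2]
  have hsq : ∀ z ∈ ball (0 : ℂ) R, 0 < R ^ 2 - ‖z‖ ^ 2 := by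
    intro z hz
    have : ‖z‖ < R := by simpa using hz
    nlinarith [norm_nonneg z]
  refine ⟨fun w => circleAverage (fun ζ => herglotzRieszKernel 0 w ζ •
    ((|Real.log ‖h ζ‖| : ℝ) : ℂ)) 0 R,
    analyticOnNhd_circleAverage_herglotzRieszKernel_smul (circleIntegrable_ofReal hint), ?_, ?_, ?_⟩
  · intro z hz
    rw [hre z hz]
    refine circleAverage_nonneg_of_nonneg fun ζ hζ => ?_
    simp only [Pi.smul_apply', Function.comp_apply, smul_eq_mul]
    rw [hker z hz ζ hζ]
    have := hsq z hz
    positivity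
  · rw [hre 0 (mem_ball_self hR)]
    refine circleAverage_congr_sphere fun ζ hζ => ?_
    simp only [Pi.smul_apply', Function.comp_apply, smul_eq_mul]
    have h2 : ‖ζ‖ = R := by simpa [abs_of_pos hR] using hζ
    rw [hker 0 (mem_ball_self hR) ζ hζ, norm_zero, sub_zero, h2]
    field_simp
    simp
  · intro z hz δ hδ0 hδ1 w hw
    have hzR : ‖z‖ < R := by simpa using hz
    have hwR : w ∈ ball (0 : ℂ) R := by
      have : ‖w‖ ≤ ‖w - z‖ + ‖z‖ := by simpa using norm_add_le (w - z) z
      have : ‖w‖ < R := by nlinarith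
      simpa using this
    rw [logDeriv_eq_circleAverage hh hne hwR, hre z hz, ← smul_eq_mul, ← smul_eq_mul,
      ← circleAverage_smul, ← circleAverage_smul]
    refine norm_circleAverage_le ?_ ?_
    · have h1 : CircleIntegrable ((Complex.re ∘ herglotzRieszKernel 0 z) •
          fun ζ => |Real.log ‖h ζ‖|) 0 R := by
        apply ContinuousOn.circleIntegrable'
        refine ContinuousOn.smul ?_ hcont
        exact Complex.continuous_re.comp_continuousOn (continuousOn_herglotzRieszKernel_sphere hz)
      exact (h1.const_smul).const_smul
    · intro ζ hζ
      have h2 : ‖ζ‖ = R := by simpa [abs_of_pos hR] using hζ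
      simp only [Pi.smul_apply, Pi.mul_apply, Function.comp_apply, smul_eq_mul]
      rw [hker z hz ζ hζ, norm_mul, Complex.norm_real, Real.norm_eq_abs, norm_div, norm_mul,
        norm_pow, h2, Complex.norm_ofNat]
      have h3 : R - ‖z‖ ≤ ‖ζ - z‖ := by simpa [h2] using norm_sub_norm_le ζ z
      have h4 : (1 - δ) * ‖ζ - z‖ ≤ ‖ζ - w‖ := by
        have := norm_sub_le_norm_sub_add_norm_sub ζ w z
        nlinarith
      have h5 : 0 < ‖ζ - z‖ := by linarith
      have h6 : 0 < 1 - δ := by linarith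
      have h7 := hsq z hz
      calc 2 * R / ‖ζ - w‖ ^ 2 * |Real.log ‖h ζ‖|
          ≤ 2 * R / ((1 - δ) * ‖ζ - z‖) ^ 2 * |Real.log ‖h ζ‖| := by gcongr
        _ = _ := by field_simp

/-- The bound of the previous theorem, with Cauchy's estimates for the higher derivatives. -/
theorem exists_re_nonneg_norm_iteratedDeriv_logDeriv_le {h : ℂ → ℂ} {R : ℝ} (hR : 0 < R)
    (hh : AnalyticOnNhd ℂ h (closedBall 0 R)) (hne : ∀ z ∈ closedBall 0 R, h z ≠ 0) :
    ∃ V : ℂ → ℂ, AnalyticOnNhd ℂ V (ball 0 R) ∧ (∀ z ∈ ball (0 : ℂ) R, 0 ≤ (V z).re) ∧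
      (V 0).re = circleAverage (fun ζ => |Real.log ‖h ζ‖|) 0 R ∧
      (∀ z ∈ ball (0 : ℂ) R,
        ‖logDeriv h z‖ ≤ 2 * R / (R ^ 2 - ‖z‖ ^ 2) * (V z).re) ∧
      ∀ z ∈ ball (0 : ℂ) R, ∀ j : ℕ, ‖iteratedDeriv j (logDeriv h) z‖ ≤
        j.factorial * (2 * (2 * R / (R ^ 2 - ‖z‖ ^ 2) * (V z).re) * (4 / (R - ‖z‖)) ^ j) := by
  obtain ⟨V, hV, hVre, hV0, hVb⟩ := exists_re_nonneg_norm_logDeriv_le hR hh hne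
  refine ⟨V, hV, hVre, hV0, fun z hz => ?_, fun z hz j => ?_⟩
  · simpa using hVb z hz 0 le_rfl one_pos z (by simp)
  · have hzR : ‖z‖ < R := by simpa using hz
    have hsub : closedBall z ((R - ‖z‖) / 4) ⊆ ball 0 R := by
      intro w hw
      have h1 : ‖w - z‖ ≤ (R - ‖z‖) / 4 := by simpa [dist_eq_norm] using hw
      have : ‖w‖ ≤ ‖w - z‖ + ‖z‖ := by simpa using norm_add_le (w - z) z
      have : ‖w‖ < R := by linarith
      simpa using this
    have hd : DiffContOnCl ℂ (logDeriv h) (ball z ((R - ‖z‖) / 4)) := by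
      apply DifferentiableOn.diffContOnCl
      rw [closure_ball _ (by linarith)]
      intro w hw
      have hw' := ball_subset_closedBall (hsub hw)
      exact ((hh w hw').deriv.div (hh w hw') (hne w hw')).differentiableAt.differentiableWithinAt
    have := Complex.norm_iteratedDeriv_le_of_forall_mem_sphere_norm_le j (by linarith) hd
      (C := 2 * (2 * R / (R ^ 2 - ‖z‖ ^ 2) * (V z).re)) (fun w hw => ?_)
    · refine this.trans_eq ?_
      rw [div_pow, div_pow]
      have : 0 < R - ‖z‖ := by linarith
      field_simp
    · have h1 : ‖w - z‖ = (R - ‖z‖) / 4 := by simpa using hw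
      refine (hVb z hz (1 / 4) (by norm_num) (by norm_num) w (by linarith)).trans ?_
      have h2 : 0 < R ^ 2 - ‖z‖ ^ 2 := by nlinarith [norm_nonneg z]
      have h3 := hVre z hz
      gcongr
      norm_num

/-! ### Logarithmic means of functions with values in a half-plane -/

/-- The Möbius map `z ↦ (1 + α z) / (2 (1 - α z))`. It takes the disc `|α z| < 1` into the right
half-plane and the origin to `1 / 2`. -/
noncomputable def halfPlaneMap (α z : ℂ) : ℂ := (1 + α * z) / (2 * (1 - α * z))

theorem re_halfPlaneMap_nonneg {α z : ℂ} (h : ‖α * z‖ ≤ 1) : 0 ≤ (halfPlaneMap α z).re := by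
  unfold halfPlaneMap
  set w := α * z
  have hw : w.re ^ 2 + w.im ^ 2 ≤ 1 := by
    have := pow_le_pow_left₀ (norm_nonneg w) h 2
    rw [← Complex.normSq_eq_norm_sq, Complex.normSq_apply] at this
    linarith
  rw [Complex.div_re, ← add_div]
  apply div_nonneg _ (Complex.normSq_nonneg _)
  simp
  nlinarith

theorem re_inv_one_sub_nonneg {w : ℂ} (h : ‖w‖ ≤ 1) : 0 ≤ ((1 - w)⁻¹).re := by
  rw [Complex.inv_re]
  apply div_nonneg _ (Complex.normSq_nonneg _)
  have := (Complex.re_le_norm w).trans h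
  simpa using this

theorem one_sub_ne_zero_of_norm_mul_le {α z : ℂ} {r : ℝ} (hα : ‖α‖ * r ≤ 1)
    (hz : z ∈ ball (0 : ℂ) r) : 1 - α * z ≠ 0 := by
  intro h
  have h1 : ‖α‖ * ‖z‖ = 1 := by rw [← norm_mul, ← sub_eq_zero.1 h, norm_one]
  have hz' : ‖z‖ < r := by simpa using hz
  rcases eq_or_lt_of_le (norm_nonneg α) with h0 | h0
  · rw [← h0] at h1; simp at h1
  · nlinarith

theorem norm_mul_le_one_of_mem_ball {α z : ℂ} {r : ℝ} (hα : ‖α‖ * r ≤ 1)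
    (hz : z ∈ ball (0 : ℂ) r) : ‖α * z‖ ≤ 1 := by
  have hz' : ‖z‖ < r := by simpa using hz
  rw [norm_mul]
  nlinarith [norm_nonneg α]

theorem meromorphic_halfPlaneMap (α : ℂ) : Meromorphic (halfPlaneMap α) := by
  unfold halfPlaneMap
  intro x
  fun_prop

/-- Logarithmic mean of a positive combination of half-plane maps. This is a logarithmic form
of Kolmogorov's weak-type inequality; it rests on Jensen's formula, because the
function inside the logarithm has real part at least `1` in the disc. -/
theorem circleAverage_log_norm_one_add_sum_halfPlaneMap {ι : Type*} (E : Finset ι) (w w' : ι → ℝ)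
    (a b : ι → ℂ) {r t : ℝ} (hr : 0 < r) (ht : 0 ≤ t) (hw : ∀ c ∈ E, 0 ≤ w c)
    (hw' : ∀ c ∈ E, 0 ≤ w' c) (ha : ∀ c ∈ E, ‖a c‖ * r ≤ 1) (hb : ∀ c ∈ E, ‖b c‖ * r ≤ 1) :
    CircleIntegrable (fun z => Real.log ‖1 + t * ∑ c ∈ E,
      (w c * halfPlaneMap (a c) z + w' c * halfPlaneMap (b c) z)‖) 0 r ∧
    circleAverage (fun z => Real.log ‖1 + t * ∑ c ∈ E,
      (w c * halfPlaneMap (a c) z + w' c * halfPlaneMap (b c) z)‖) 0 r ≤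
        t * ((∑ c ∈ E, (w c + w' c)) / 2) := by
  set F : ℂ → ℂ := fun z => t * ∑ c ∈ E,
      (w c * halfPlaneMap (a c) z + w' c * halfPlaneMap (b c) z) with hF
  have hmer : Meromorphic F := by
    intro x
    refine (MeromorphicAt.const _ _).mul (MeromorphicAt.fun_sum fun c _ => ?_)
    exact ((MeromorphicAt.const _ _).mul (meromorphic_halfPlaneMap _ x)).add
      ((MeromorphicAt.const _ _).mul (meromorphic_halfPlaneMap _ x))
  have hq : ∀ α : ℂ, ‖α‖ * r ≤ 1 → ∀ z ∈ ball (0 : ℂ) r, AnalyticAt ℂ (halfPlaneMap α) z := by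
    intro α hα z hz
    have := one_sub_ne_zero_of_norm_mul_le hα hz
    unfold halfPlaneMap
    have h2 : (2 : ℂ) * (1 - α * z) ≠ 0 := mul_ne_zero two_ne_zero this
    fun_prop (disch := exact h2)
  have han : ∀ z ∈ ball (0 : ℂ) r, AnalyticAt ℂ F z := by
    intro z hz
    refine analyticAt_const.mul (Finset.analyticAt_fun_sum _ fun c hc => ?_)
    exact (analyticAt_const.mul (hq _ (ha c hc) z hz)).add
      (analyticAt_const.mul (hq _ (hb c hc) z hz))
  have hre : ∀ z ∈ ball (0 : ℂ) r, 0 ≤ (F z).re := by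
    intro z hz
    rw [hF, Complex.re_ofReal_mul, Complex.re_sum]
    refine mul_nonneg ht (Finset.sum_nonneg fun c hc => ?_)
    rw [Complex.add_re, Complex.re_ofReal_mul, Complex.re_ofReal_mul]
    have h1 := re_halfPlaneMap_nonneg (norm_mul_le_one_of_mem_ball (ha c hc) hz)
    have h2 := re_halfPlaneMap_nonneg (norm_mul_le_one_of_mem_ball (hb c hc) hz)
    have := hw c hc
    have := hw' c hc
    positivity
  refine ⟨circleIntegrable_log_norm_one_add hr hmer.meromorphicOn, ?_⟩
  rw [circleAverage_log_norm_one_add hr hmer.meromorphicOn han hre]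
  have hF0 : F 0 = ((t * ((∑ c ∈ E, (w c + w' c)) / 2) : ℝ) : ℂ) := by
    simp only [hF, halfPlaneMap, mul_zero, add_zero, sub_zero, mul_one]
    push_cast
    rw [Finset.sum_div]
    congr 1
    refine Finset.sum_congr rfl fun c _ => ?_
    ring
  have hnn : 0 ≤ t * ((∑ c ∈ E, (w c + w' c)) / 2) := by
    have : 0 ≤ ∑ c ∈ E, (w c + w' c) := Finset.sum_nonneg fun c hc =>
      add_nonneg (hw c hc) (hw' c hc)
    positivity
  rw [hF0, ← Complex.ofReal_one, ← Complex.ofReal_add, Complex.norm_real, Real.norm_eq_abs,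
    abs_of_nonneg (by linarith)]
  have := Real.log_le_sub_one_of_pos (x := 1 + t * ((∑ c ∈ E, (w c + w' c)) / 2)) (by linarith)
  linarith

theorem circleAverage_log_norm_one_add_inv {α : ℂ} {r t : ℝ} (hr : 0 < r) (ht : 0 ≤ t)
    (hα : ‖α‖ * r ≤ 1) :
    CircleIntegrable (fun z => Real.log ‖1 + t * (1 - α * z)⁻¹‖) 0 r ∧
    circleAverage (fun z => Real.log ‖1 + t * (1 - α * z)⁻¹‖) 0 r ≤ t := by
  have hmer : Meromorphic fun z => (t : ℂ) * (1 - α * z)⁻¹ := by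
    intro x
    fun_prop
  refine ⟨circleIntegrable_log_norm_one_add hr hmer.meromorphicOn, ?_⟩
  rw [circleAverage_log_norm_one_add hr hmer.meromorphicOn]
  · simp only [mul_zero, sub_zero, inv_one, mul_one]
    rw [← Complex.ofReal_one, ← Complex.ofReal_add, Complex.norm_real, Real.norm_eq_abs,
      abs_of_nonneg (by linarith)]
    have := Real.log_le_sub_one_of_pos (x := 1 + t) (by linarith)
    linarith
  · intro z hz
    have := one_sub_ne_zero_of_norm_mul_le hα hz
    fun_prop (disch := exact this)
  · intro z hz
    rw [Complex.re_ofReal_mul]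
    exact mul_nonneg ht (re_inv_one_sub_nonneg (norm_mul_le_one_of_mem_ball hα hz))

theorem log_one_add_sum_le {ι : Type*} (E : Finset ι) (m : ι → ℕ) (y : ι → ℝ)
    (hy : ∀ c ∈ E, 0 ≤ y c) :
    Real.log (1 + ∑ c ∈ E, m c * y c) ≤ ∑ c ∈ E, m c * Real.log (1 + y c) := by
  classical
  induction E using Finset.induction_on with
  | empty => simp
  | insert c E hc ih =>
    rw [Finset.sum_insert hc, Finset.sum_insert hc]
    have h1 : 0 ≤ y c := hy c (Finset.mem_insert_self _ _)
    have h2 : ∀ d ∈ E, 0 ≤ y d := fun d hd => hy d (Finset.mem_insert_of_mem hd)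
    have h3 : 0 ≤ ∑ d ∈ E, m d * y d := Finset.sum_nonneg fun d hd =>
      mul_nonneg (Nat.cast_nonneg _) (h2 d hd)
    have h4 : 0 ≤ (m c : ℝ) * y c := mul_nonneg (Nat.cast_nonneg _) h1
    calc Real.log (1 + (m c * y c + ∑ d ∈ E, m d * y d))
        ≤ Real.log ((1 + y c) ^ m c * (1 + ∑ d ∈ E, m d * y d)) := by
          apply Real.log_le_log (by positivity)
          have := one_add_mul_le_pow (a := y c) (by linarith) (m c)
          nlinarith
      _ = m c * Real.log (1 + y c) + Real.log (1 + ∑ d ∈ E, m d * y d) := by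
          rw [Real.log_mul (by positivity) (by positivity), Real.log_pow]
      _ ≤ _ := by linarith [ih h2]

/-! ### Sums over zeros and poles -/

/-- The parameter of the half-plane map that describes `(z + c) / (2 (z - c))` on the circle
`|z| = r`: up to complex conjugation if `|c| ≤ r`, and up to sign if `|c| > r`. -/
noncomputable def poleParam (r : ℝ) (c : ℂ) : ℂ := if ‖c‖ ≤ r then conj c / r ^ 2 else 1 / c

theorem norm_poleParam_mul_le {r : ℝ} (hr : 0 < r) (c : ℂ) : ‖poleParam r c‖ * r ≤ 1 := by
  unfold poleParam
  split_ifs with h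
  · rw [norm_div, norm_pow, Complex.norm_real, Real.norm_eq_abs, abs_of_pos hr, Complex.norm_conj,
      div_mul_eq_mul_div, div_le_one (by positivity)]
    nlinarith
  · rw [norm_div, norm_one, div_mul_eq_mul_div, one_mul, div_le_one] <;> linarith

theorem norm_conj_div_sq_mul_le {r R : ℝ} (hr : 0 < r) (hrR : r < R) {c : ℂ} (hc : ‖c‖ < R) :
    ‖conj c / (R : ℂ) ^ 2‖ * r ≤ 1 := by
  have hR : 0 < R := hr.trans hrR
  rw [norm_div, norm_pow, Complex.norm_real, Real.norm_eq_abs, abs_of_pos hR, Complex.norm_conj,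
    div_mul_eq_mul_div, div_le_one (by positivity)]
  nlinarith [norm_nonneg c]

theorem sq_sub_conj_mul_ne_zero {R : ℝ} {c z : ℂ} (hc : ‖c‖ < R) (hz : ‖z‖ ≤ R) :
    (R : ℂ) ^ 2 - conj c * z ≠ 0 := by
  intro h
  have hR : 0 < R := (norm_nonneg c).trans_lt hc
  have h1 : ‖conj c * z‖ = R ^ 2 := by
    rw [← sub_eq_zero.1 h, norm_pow, Complex.norm_real, Real.norm_eq_abs, abs_of_pos hR]
  rw [norm_mul, Complex.norm_conj] at h1
  nlinarith [norm_nonneg c, norm_nonneg z]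

theorem mul_conj_of_mem_sphere {r : ℝ} {z : ℂ} (hz : ‖z‖ = r) : z * conj z = (r : ℂ) ^ 2 := by
  rw [Complex.mul_conj, Complex.normSq_eq_norm_sq, hz]
  push_cast; rfl

/-- On the circle `|z| = r`, the singular term `1 / (z - c)` of a logarithmic derivative, together
with its reflection, is a combination of half-plane maps without constant term. -/
theorem mul_pole_add_reflection {r R : ℝ} (hr : 0 < r) (hrR : r < R) {c z : ℂ} (hc : ‖c‖ < R)
    (hz : ‖z‖ = r) (hzc : z ≠ c) :
    z * (1 / (z - c) + conj c / (R ^ 2 - conj c * z)) =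
      (if ‖c‖ ≤ r then conj (halfPlaneMap (poleParam r c) z) else
        -halfPlaneMap (poleParam r c) z) + halfPlaneMap (conj c / R ^ 2) z := by
  have hR : 0 < R := hr.trans hrR
  have hRC : (R : ℂ) ≠ 0 := by exact_mod_cast hR.ne'
  have hrC : (r : ℂ) ≠ 0 := by exact_mod_cast hr.ne'
  have hz0 : z ≠ 0 := by rw [← norm_pos_iff, hz]; exact hr
  have hzc' : z - c ≠ 0 := sub_ne_zero.2 hzc
  have hden : (R : ℂ) ^ 2 - conj c * z ≠ 0 := sq_sub_conj_mul_ne_zero hc (by rw [hz]; exact hrR.le)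
  have h2 : halfPlaneMap (conj c / R ^ 2) z = z * (conj c / (R ^ 2 - conj c * z)) + 1 / 2 := by
    unfold halfPlaneMap
    have : 1 - conj c / (R : ℂ) ^ 2 * z = (R ^ 2 - conj c * z) / R ^ 2 := by field_simp
    rw [this]
    field_simp
    ring
  have h1 : z * (1 / (z - c)) - 1 / 2 = (if ‖c‖ ≤ r then conj (halfPlaneMap (poleParam r c) z) else
        -halfPlaneMap (poleParam r c) z) := by
    unfold halfPlaneMap poleParam
    split_ifs with h
    · have hzz := mul_conj_of_mem_sphere hz
      have hcz : conj z ≠ 0 := by simpa using hz0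
      have : c / (r : ℂ) ^ 2 * conj z = c / z := by
        rw [← hzz]; field_simp
      simp only [map_div₀, map_add, map_one, map_mul, map_sub, Complex.conj_conj, map_pow,
        Complex.conj_ofReal, this, map_ofNat]
      have h3 : 1 - c / z = (z - c) / z := by field_simp
      rw [h3]
      field_simp
      ring
    · have hc0 : c ≠ 0 := by rintro rfl; simp at h; linarith
      have h3 : 1 - 1 / c * z = -(z - c) / c := by field_simp; ring
      rw [h3]
      field_simp
      ring
  rw [mul_add, ← h1, h2]
  ring

theorem norm_mul_pole_le {r : ℝ} (hr : 0 < r) {c z : ℂ} (hz : ‖z‖ = r) (hzc : z ≠ c) :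
    r * ‖1 / (z - c)‖ ≤ ‖(1 - poleParam r c * z)⁻¹‖ := by
  have hzc' : z - c ≠ 0 := sub_ne_zero.2 hzc
  have hz0 : z ≠ 0 := by rw [← norm_pos_iff, hz]; exact hr
  unfold poleParam
  split_ifs with h
  · have hzz := mul_conj_of_mem_sphere hz
    have hcz : conj z ≠ 0 := by simpa using hz0
    have : 1 - conj c / (r : ℂ) ^ 2 * z = conj ((z - c) / z) := by
      rw [← hzz, map_div₀, map_sub]; field_simp
    rw [this, norm_inv, Complex.norm_conj, norm_div, norm_div, norm_one, hz, inv_div, mul_one_div]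
  · have hc0 : c ≠ 0 := by rintro rfl; simp at h; linarith
    have h3 : 1 - 1 / c * z = -(z - c) / c := by field_simp; ring
    rw [h3, norm_inv, norm_div, norm_div, norm_neg, norm_one, inv_div, mul_one_div]
    gcongr
    linarith

theorem norm_mul_reflection_le {r R : ℝ} (hr : 0 < r) (hrR : r < R) {c : ℂ} (z : ℂ) (hc : ‖c‖ < R) :
    r * ‖conj c / (R ^ 2 - conj c * z)‖ ≤ ‖(1 - conj c / R ^ 2 * z)⁻¹‖ := by
  have hR : 0 < R := hr.trans hrR
  have hRC : (R : ℂ) ≠ 0 := by exact_mod_cast hR.ne'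
  have : 1 - conj c / (R : ℂ) ^ 2 * z = (R ^ 2 - conj c * z) / R ^ 2 := by field_simp
  rw [this, norm_inv, norm_div, norm_div, inv_div, norm_pow, Complex.norm_real, Real.norm_eq_abs,
    abs_of_pos hR, Complex.norm_conj, ← mul_div_assoc]
  gcongr
  nlinarith [norm_nonneg c]

theorem log_one_add_sq_le {t : ℝ} (ht : 0 ≤ t) {w : ℂ} (hw : 0 ≤ w.re) :
    Real.log (1 + t ^ 2 * ‖w‖ ^ 2) ≤ 2 * Real.log ‖1 + t * w‖ := by
  have h1 : 0 ≤ ((t : ℂ) * w).re := by rw [Complex.re_ofReal_mul]; positivity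
  have h2 := one_add_sq_norm_le h1
  rw [norm_mul, Complex.norm_real, Real.norm_eq_abs, abs_of_nonneg ht, mul_pow] at h2
  have h3 := Real.log_le_log (by positivity) h2
  rwa [Real.log_pow, Nat.cast_ofNat] at h3

/-- Logarithmic mean of the square function of the poles `1 / (z - c)` and their reflections. The
logarithm of the sum of squares is subadditive over the terms, and each term is the squared modulus
of a function with nonnegative real part on the disc. -/
theorem exists_circleIntegrable_squareSum_le (E : Finset ℂ) (ν : ℂ → ℕ) {r R η : ℝ} (hr : 0 < r)
    (hrR : r < R) (hη : 0 < η) (hE : ∀ c ∈ E, ‖c‖ < R) :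
    ∃ U : ℂ → ℝ, CircleIntegrable U 0 r ∧ circleAverage U 0 r ≤ 2 * η * ∑ c ∈ E, (ν c : ℝ) ∧
      ∀ z ∈ sphere (0 : ℂ) r, 0 ≤ U z ∧ (z ∉ E →
        (η * r) ^ 2 * ∑ c ∈ E, (ν c : ℝ) *
          (‖1 / (z - c)‖ ^ 2 + ‖conj c / (R ^ 2 - conj c * z)‖ ^ 2) ≤ Real.exp (U z) ^ 2) := by
  have ha := fun c (_ : c ∈ E) => circleAverage_log_norm_one_add_inv hr hη.le
    (norm_poleParam_mul_le hr c)
  have hb := fun c (hc : c ∈ E) => circleAverage_log_norm_one_add_inv hr hη.le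
    (norm_conj_div_sq_mul_le hr hrR (hE c hc))
  set A : ℂ → ℂ → ℝ := fun c z => Real.log ‖1 + (η : ℂ) * (1 - poleParam r c * z)⁻¹‖ with hA
  set B : ℂ → ℂ → ℝ := fun c z => Real.log ‖1 + (η : ℂ) * (1 - conj c / (R : ℂ) ^ 2 * z)⁻¹‖ with hB
  have hint : ∀ c ∈ E, CircleIntegrable (fun z => (ν c : ℝ) • (A c z + B c z)) 0 r := fun c hc =>
    ((ha c hc).1.add (hb c hc).1).const_smul (a := (ν c : ℝ))
  refine ⟨fun z => ∑ c ∈ E, (ν c : ℝ) • (A c z + B c z), CircleIntegrable.fun_sum E hint, ?_, ?_⟩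
  · rw [circleAverage_fun_sum hint, Finset.mul_sum]
    refine Finset.sum_le_sum fun c hc => ?_
    rw [circleAverage_fun_smul, circleAverage_fun_add (ha c hc).1 (hb c hc).1, smul_eq_mul]
    have h1 := (ha c hc).2
    have h2 := (hb c hc).2
    have : (0 : ℝ) ≤ ν c := Nat.cast_nonneg _
    nlinarith
  · intro z hz
    have hz' : ‖z‖ = r := by simpa using hz
    have hra : ∀ c, 0 ≤ ((1 - poleParam r c * z)⁻¹).re := fun c =>
      re_inv_one_sub_nonneg (by rw [norm_mul, hz']; exact norm_poleParam_mul_le hr c)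
    have hrb : ∀ c ∈ E, 0 ≤ ((1 - conj c / R ^ 2 * z)⁻¹).re := fun c hc =>
      re_inv_one_sub_nonneg (by rw [norm_mul, hz']; exact norm_conj_div_sq_mul_le hr hrR (hE c hc))
    have hAn : ∀ c, 0 ≤ A c z := fun c => Real.log_nonneg <| one_le_norm_one_add <| by
      rw [Complex.re_ofReal_mul]; exact mul_nonneg hη.le (hra c)
    have hBn : ∀ c ∈ E, 0 ≤ B c z := fun c hc => Real.log_nonneg <| one_le_norm_one_add <| by
      rw [Complex.re_ofReal_mul]; exact mul_nonneg hη.le (hrb c hc)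
    refine ⟨Finset.sum_nonneg fun c hc => smul_nonneg (Nat.cast_nonneg _)
      (add_nonneg (hAn c) (hBn c hc)), fun hzE => ?_⟩
    set y : ℂ → ℝ := fun c => η ^ 2 * ‖(1 - poleParam r c * z)⁻¹‖ ^ 2 +
      η ^ 2 * ‖(1 - conj c / R ^ 2 * z)⁻¹‖ ^ 2 with hy
    have hy0 : ∀ c, 0 ≤ y c := fun c => by positivity
    have hlog : Real.log (1 + ∑ c ∈ E, ν c * y c) ≤ 2 * ∑ c ∈ E, (ν c : ℝ) • (A c z + B c z) := by
      refine (log_one_add_sum_le E ν y fun c _ => hy0 c).trans ?_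
      rw [Finset.mul_sum]
      refine Finset.sum_le_sum fun c hc => ?_
      have h1 : Real.log (1 + y c) ≤ 2 * A c z + 2 * B c z := by
        refine le_trans ?_ (add_le_add (log_one_add_sq_le hη.le (hra c))
          (log_one_add_sq_le hη.le (hrb c hc)))
        rw [← Real.log_mul (by positivity) (by positivity)]
        apply Real.log_le_log (by have := hy0 c; positivity)
        have : 0 ≤ η ^ 2 * ‖(1 - poleParam r c * z)⁻¹‖ ^ 2 *
          (η ^ 2 * ‖(1 - conj c / R ^ 2 * z)⁻¹‖ ^ 2) := by positivity
        simp only [hy]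
        linarith
      have : (0 : ℝ) ≤ ν c := Nat.cast_nonneg _
      rw [smul_eq_mul]
      nlinarith
    have hle : (η * r) ^ 2 * ∑ c ∈ E, (ν c : ℝ) *
        (‖1 / (z - c)‖ ^ 2 + ‖conj c / (R ^ 2 - conj c * z)‖ ^ 2) ≤ ∑ c ∈ E, ν c * y c := by
      rw [Finset.mul_sum]
      refine Finset.sum_le_sum fun c hc => ?_
      have h1 := norm_mul_pole_le hr hz' (c := c) (by rintro rfl; exact hzE hc)
      have h2 := norm_mul_reflection_le hr hrR z (hE c hc)
      have h3 := pow_le_pow_left₀ (by positivity) h1 2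
      have h4 := pow_le_pow_left₀ (by positivity) h2 2
      have : (0 : ℝ) ≤ ν c := Nat.cast_nonneg _
      calc _ = ν c * (η ^ 2 * (r * ‖1 / (z - c)‖) ^ 2 +
              η ^ 2 * (r * ‖conj c / (R ^ 2 - conj c * z)‖) ^ 2) := by ring
        _ ≤ _ := by simp only [hy]; gcongr
    have hpos : 0 < 1 + ∑ c ∈ E, ν c * y c := by
      have : 0 ≤ ∑ c ∈ E, ν c * y c :=
        Finset.sum_nonneg fun c _ => mul_nonneg (Nat.cast_nonneg _) (hy0 c)
      linarith
    have := (Real.log_le_iff_le_exp hpos).1 hlog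
    rw [← Real.exp_nat_mul]
    push_cast
    linarith

/-- Logarithmic mean of the sum of the poles `1 / (z - c)` and their reflections, weighted by the
signed multiplicities. Up to conjugations the sum is a combination of four functions with
nonnegative real part, according to the sign of the multiplicity and to whether `c` lies in the
disc `|c| ≤ r`; the constant terms `1 / 2` cancel between each pole and its reflection. -/
theorem exists_circleIntegrable_norm_sum_le (E : Finset ℂ) (ν : ℂ → ℤ) {r R t : ℝ} (hr : 0 < r)
    (hrR : r < R) (ht : 0 < t) (hE : ∀ c ∈ E, ‖c‖ < R) :
    ∃ U : ℂ → ℝ, CircleIntegrable U 0 r ∧ circleAverage U 0 r ≤ t * ∑ c ∈ E, ((ν c).natAbs : ℝ) ∧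
      ∀ z ∈ sphere (0 : ℂ) r, 0 ≤ U z ∧ (z ∉ E →
        t * r * ‖∑ c ∈ E, (ν c : ℂ) * (1 / (z - c) + conj c / (R ^ 2 - conj c * z))‖ ≤
          4 * Real.exp (U z)) := by
  have ha := fun c (_ : c ∈ E) => norm_poleParam_mul_le hr c
  have hb := fun c (hc : c ∈ E) => norm_conj_div_sq_mul_le hr hrR (hE c hc)
  set p : ℂ → ℝ := fun c => ((ν c)⁺ : ℤ) with hp
  set q : ℂ → ℝ := fun c => ((ν c)⁻ : ℤ) with hq
  have hp0 : ∀ c, 0 ≤ p c := fun c => Int.cast_nonneg (posPart_nonneg _)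
  have hq0 : ∀ c, 0 ≤ q c := fun c => Int.cast_nonneg (negPart_nonneg _)
  have hpq : ∀ c, (ν c : ℝ) = p c - q c := fun c => by
    simp only [hp, hq]; rw [← Int.cast_sub, posPart_sub_negPart]
  have hpq' : ∀ c, ((ν c).natAbs : ℝ) = p c + q c := fun c => by
    simp only [hp, hq]; rw [← Int.cast_add, posPart_add_negPart, Nat.cast_natAbs]
  set inn : (ℂ → ℝ) → ℂ → ℝ := fun u c => if ‖c‖ ≤ r then u c else 0 with hinn
  set out : (ℂ → ℝ) → ℂ → ℝ := fun u c => if ‖c‖ ≤ r then 0 else u c with hout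
  have hinn0 : ∀ u, (∀ c, 0 ≤ u c) → ∀ c ∈ E, 0 ≤ inn u c := fun u hu c _ => by
    simp only [hinn]; split_ifs <;> simp [hu]
  have hout0 : ∀ u, (∀ c, 0 ≤ u c) → ∀ c ∈ E, 0 ≤ out u c := fun u hu c _ => by
    simp only [hout]; split_ifs <;> simp [hu]
  set S : (ℂ → ℝ) → (ℂ → ℝ) → ℂ → ℂ := fun w w' z => ∑ c ∈ E,
    (w c * halfPlaneMap (poleParam r c) z + w' c * halfPlaneMap (conj c / R ^ 2) z) with hS
  have key := fun w w' hw hw' => circleAverage_log_norm_one_add_sum_halfPlaneMap E w w'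
    (poleParam r) (fun c => conj c / R ^ 2) hr ht.le hw hw' ha hb
  have k1 := key (inn p) 0 (hinn0 p hp0) (fun _ _ => le_rfl)
  have k2 := key (inn q) 0 (hinn0 q hq0) (fun _ _ => le_rfl)
  have k3 := key (out q) p (hout0 q hq0) (fun c _ => hp0 c)
  have k4 := key (out p) q (hout0 p hp0) (fun c _ => hq0 c)
  set U : (ℂ → ℝ) → (ℂ → ℝ) → ℂ → ℝ := fun w w' z => Real.log ‖1 + t * S w w' z‖ with hU
  have i1 : CircleIntegrable (U (inn p) 0) 0 r := k1.1
  have i2 : CircleIntegrable (U (inn q) 0) 0 r := k2.1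
  have i3 : CircleIntegrable (U (out q) p) 0 r := k3.1
  have i4 : CircleIntegrable (U (out p) q) 0 r := k4.1
  refine ⟨(U (inn p) 0 + U (inn q) 0) + (U (out q) p + U (out p) q),
    (i1.add i2).add (i3.add i4), ?_, ?_⟩
  · rw [circleAverage_add (i1.add i2) (i3.add i4), circleAverage_add i1 i2,
      circleAverage_add i3 i4]
    refine (add_le_add (add_le_add k1.2 k2.2) (add_le_add k3.2 k4.2)).trans_eq ?_
    rw [← mul_add, ← mul_add, ← mul_add]
    congr 1
    rw [← add_div, ← add_div, ← add_div, ← Finset.sum_add_distrib, ← Finset.sum_add_distrib,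
      ← Finset.sum_add_distrib, Finset.sum_div]
    refine Finset.sum_congr rfl fun c _ => ?_
    rw [hpq']
    simp only [hinn, hout, Pi.zero_apply]
    split_ifs <;> ring
  · intro z hz
    have hz' : ‖z‖ = r := by simpa using hz
    have hre : ∀ w w', (∀ c ∈ E, 0 ≤ w c) → (∀ c ∈ E, 0 ≤ w' c) → 0 ≤ (t * S w w' z).re := by
      intro w w' hw hw'
      rw [Complex.re_ofReal_mul, Complex.re_sum]
      refine mul_nonneg ht.le (Finset.sum_nonneg fun c hc => ?_)
      rw [Complex.add_re, Complex.re_ofReal_mul, Complex.re_ofReal_mul]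
      have h1 : 0 ≤ (halfPlaneMap (poleParam r c) z).re :=
        re_halfPlaneMap_nonneg (by rw [norm_mul, hz']; exact ha c hc)
      have h2 : 0 ≤ (halfPlaneMap (conj c / R ^ 2) z).re :=
        re_halfPlaneMap_nonneg (by rw [norm_mul, hz']; exact hb c hc)
      have := hw c hc
      have := hw' c hc
      positivity
    have hUn : ∀ w w', (∀ c ∈ E, 0 ≤ w c) → (∀ c ∈ E, 0 ≤ w' c) →
        0 ≤ U w w' z ∧ t * ‖S w w' z‖ ≤ Real.exp (U w w' z) := by
      intro w w' hw hw'
      have h1 := one_le_norm_one_add (hre w w' hw hw')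
      refine ⟨Real.log_nonneg h1, ?_⟩
      have h2 := norm_le_norm_one_add (hre w w' hw hw')
      rw [norm_mul, Complex.norm_real, Real.norm_eq_abs, abs_of_pos ht] at h2
      simp only [hU]
      rwa [Real.exp_log (by linarith)]
    obtain ⟨n1, m1⟩ := hUn (inn p) 0 (hinn0 p hp0) (fun _ _ => le_rfl)
    obtain ⟨n2, m2⟩ := hUn (inn q) 0 (hinn0 q hq0) (fun _ _ => le_rfl)
    obtain ⟨n3, m3⟩ := hUn (out q) p (hout0 q hq0) (fun c _ => hp0 c)
    obtain ⟨n4, m4⟩ := hUn (out p) q (hout0 p hp0) (fun c _ => hq0 c)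
    simp only [Pi.add_apply]
    refine ⟨by positivity, fun hzE => ?_⟩
    have hdecomp : z * ∑ c ∈ E, (ν c : ℂ) * (1 / (z - c) + conj c / (R ^ 2 - conj c * z)) =
        conj (S (inn p) 0 z) - conj (S (inn q) 0 z) + (S (out q) p z - S (out p) q z) := by
      simp only [hS, map_sum]
      rw [Finset.mul_sum, ← Finset.sum_sub_distrib, ← Finset.sum_sub_distrib,
        ← Finset.sum_add_distrib]
      refine Finset.sum_congr rfl fun c hc => ?_
      rw [mul_left_comm, mul_pole_add_reflection hr hrR (hE c hc) hz' (by rintro rfl; exact hzE hc)]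
      have : (ν c : ℂ) = (p c : ℂ) - q c := by rw [← Complex.ofReal_sub, ← hpq]; simp
      rw [this]
      simp only [hinn, hout, Pi.zero_apply]
      split_ifs
      · simp; ring
      · simp; ring
    have hnorm : r * ‖∑ c ∈ E, (ν c : ℂ) * (1 / (z - c) + conj c / (R ^ 2 - conj c * z))‖ ≤
        ‖S (inn p) 0 z‖ + ‖S (inn q) 0 z‖ + (‖S (out q) p z‖ + ‖S (out p) q z‖) := by
      rw [← hz', ← norm_mul, hdecomp]
      refine (norm_add_le _ _).trans (add_le_add ((norm_sub_le _ _).trans_eq ?_) (norm_sub_le _ _))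
      rw [Complex.norm_conj, Complex.norm_conj]
    have e1 : ∀ u, u ≤ (U (inn p) 0 z + U (inn q) 0 z) + (U (out q) p z + U (out p) q z) →
        Real.exp u ≤ Real.exp
          ((U (inn p) 0 z + U (inn q) 0 z) + (U (out q) p z + U (out p) q z)) := fun u hu =>
      Real.exp_le_exp.2 hu
    have e2 := e1 (U (inn p) 0 z) (by linarith)
    have e3 := e1 (U (inn q) 0 z) (by linarith)
    have e4 := e1 (U (out q) p z) (by linarith)
    have e5 := e1 (U (out p) q z) (by linarith)
    have := mul_le_mul_of_nonneg_left hnorm ht.le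
    linarith

/-! ### Decomposition of the logarithmic derivative -/

theorem eventually_nhdsNE_of_codiscreteWithin {U : Set ℂ} {p : ℂ → Prop}
    (h : ∀ᶠ z in codiscreteWithin U, p z) {z : ℂ} (hz : U ∈ 𝓝 z) : ∀ᶠ w in 𝓝[≠] z, p w := by
  have h1 := mem_codiscreteWithin_iff_forall_mem_nhdsNE.1 h z (mem_of_mem_nhds hz)
  filter_upwards [h1, mem_nhdsWithin_of_mem_nhds hz] with w hw hwU
  rcases hw with hw | hw
  · exact hw
  · exact absurd hwU hw

/-- The logarithmic derivative of a Blaschke factor of the disc of radius `R`: a pole at the zero `c`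
of its denominator, and the reflection of that pole in the circle `|z| = R`. -/
theorem logDeriv_canonicalFactor {R : ℝ} {c z : ℂ} (hc : ‖c‖ < R) (hz : ‖z‖ ≤ R) (hzc : z ≠ c) :
    logDeriv (canonicalFactor R c) z = -(1 / (z - c) + conj c / (R ^ 2 - conj c * z)) := by
  have hR : (R : ℂ) ≠ 0 := by exact_mod_cast ((norm_nonneg c).trans_lt hc).ne'
  have h1 := sq_sub_conj_mul_ne_zero hc hz
  have h2 : z - c ≠ 0 := sub_ne_zero.2 hzc
  have d1 : HasDerivAt (fun w : ℂ => (R : ℂ) ^ 2 - conj c * w) (-conj c) z := by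
    simpa using ((hasDerivAt_id z).const_mul (conj c)).const_sub ((R : ℂ) ^ 2)
  have d2 : HasDerivAt (fun w : ℂ => (R : ℂ) * (w - c)) R z := by
    simpa using ((hasDerivAt_id z).sub_const c).const_mul (R : ℂ)
  rw [canonicalFactor_def, logDeriv_div (f := fun w : ℂ => (R : ℂ) ^ 2 - conj c * w)
    (g := fun w : ℂ => (R : ℂ) * (w - c)) z h1 (mul_ne_zero hR h2) d1.differentiableAt
    d2.differentiableAt, logDeriv_apply, logDeriv_apply, d1.deriv, d2.deriv]
  field_simp
  ring

/-- Near a regular point in the disc, the logarithmic derivative of `f` splits into a sum over its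
zeros and poles with their reflections and the logarithmic derivative of a zero-free function. -/
theorem exists_logDeriv_eq_sum {f : ℂ → ℂ} (hf : Meromorphic f)
    (hft : ∀ z, meromorphicOrderAt f z ≠ ⊤) {R : ℝ}
    (hS : ∀ z ∈ sphere (0 : ℂ) R, meromorphicOrderAt f z = 0) :
    ∃ (E : Finset ℂ) (h : ℂ → ℂ), (∀ c ∈ E, ‖c‖ < R) ∧ AnalyticOnNhd ℂ h (closedBall 0 R) ∧
      (∀ z ∈ closedBall 0 R, h z ≠ 0) ∧
      (∀ᶠ z in codiscreteWithin (sphere (0 : ℂ) R), ‖f z‖ = ‖h z‖) ∧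
      ∀ z ∈ ball (0 : ℂ) R, z ∉ E → AnalyticAt ℂ f z → f z ≠ 0 ∧
        logDeriv f =ᶠ[𝓝 z] fun w => (∑ c ∈ E, (divisor f univ c : ℂ) *
          (1 / (w - c) + conj c / (R ^ 2 - conj c * w))) + logDeriv h w := by
  have hfR : MeromorphicOn f (closedBall 0 R) := hf.meromorphicOn
  obtain ⟨h, D⟩ := hfR.exists_ecanonicalDecomp fun u => hft u
  have hfin : (divisor f (ball 0 R)).support.Finite := hfR.divisor_ball_support_finite
  set E := hfin.toFinset with hE
  have hEb : ∀ c ∈ E, c ∈ ball (0 : ℂ) R := fun c hc =>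
    (divisor f (ball 0 R)).supportWithinDomain (hfin.mem_toFinset.1 hc)
  have hEn : ∀ c ∈ E, ‖c‖ < R := fun c hc => by simpa using hEb c hc
  have hdivE : ∀ c ∈ E, divisor f (ball 0 R) c = divisor f univ c := fun c hc => by
    rw [divisor_apply hf.meromorphicOn (hEb c hc), divisor_apply hf.meromorphicOn (mem_univ c)]
  set B : ℂ → ℂ := fun w => ∏ c ∈ E, canonicalFactor R c w ^ (-divisor f univ c) with hB
  have hfB : f =ᶠ[codiscreteWithin (closedBall 0 R)] fun w => B w * h w := by
    filter_upwards [D.eventuallyEq] with w hw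
    rw [hw, finprod_eq_prod_of_mulSupport_subset (s := E)]
    · have : ∏ᶠ v : ℂ, (fun w : ℂ => w - v) ^ (divisor f (sphere 0 R)) v = 1 := by
        refine finprod_eq_one_of_forall_eq_one fun v => ?_
        by_cases hv : v ∈ sphere (0 : ℂ) R
        · rw [divisor_apply hf.meromorphicOn hv, hS v hv]; rfl
        · rw [Function.locallyFinsuppWithin.apply_eq_zero_of_notMem _ hv, zpow_zero]
      rw [this, mul_one, Pi.smul_apply', smul_eq_mul, Finset.prod_apply]
      congr 1
      refine Finset.prod_congr rfl fun c hc => ?_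
      rw [Pi.pow_apply, hdivE c hc]
    · intro c hc
      rw [hE, hfin.coe_toFinset, Function.mem_support]
      intro h0
      exact hc (by simp [h0])
  have hfac : ∀ c ∈ E, ∀ w, ‖w‖ ≤ R → w ≠ c → canonicalFactor R c w ≠ 0 := fun c hc w hw hwc =>
    canonicalFactor_ne_zero (hEb c hc) (by simpa using hw) hwc
  have hfacd : ∀ c : ℂ, ∀ w, w ≠ c → AnalyticAt ℂ (canonicalFactor R c) w := fun c w hwc =>
    analyticOnNhd_canonicalFactor R c w hwc
  refine ⟨E, h, hEn, D.analyticOnNhd, D.ne_zero, ?_, ?_⟩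
  · filter_upwards [codiscreteWithin_mono sphere_subset_closedBall hfB,
      self_mem_codiscreteWithin (sphere (0 : ℂ) R)] with z hz hzS
    rw [hz, norm_mul, hB, norm_prod, Finset.prod_eq_one, one_mul]
    intro c hc
    rw [norm_zpow, norm_canonicalFactor_eval_circle_eq_one (hEb c hc) hzS, one_zpow]
  · intro z hz hzE hfa
    have hBh : ∀ w ∈ ball (0 : ℂ) R, w ∉ E → AnalyticAt ℂ B w ∧ B w ≠ 0 := by
      intro w hw hwE
      have hwR : ‖w‖ ≤ R := le_of_lt (by simpa using hw)
      have hwc : ∀ c ∈ E, w ≠ c := fun c hc h0 => hwE (h0 ▸ hc)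
      refine ⟨Finset.analyticAt_fun_prod _ fun c hc => (hfacd c w (hwc c hc)).zpow
        (hfac c hc w hwR (hwc c hc)), Finset.prod_ne_zero_iff.2 fun c hc =>
        zpow_ne_zero _ (hfac c hc w hwR (hwc c hc))⟩
    have hnhds : closedBall (0 : ℂ) R ∈ 𝓝 z :=
      mem_of_superset (isOpen_ball.mem_nhds hz) ball_subset_closedBall
    have hBz := hBh z hz hzE
    have hhz := D.analyticOnNhd z (ball_subset_closedBall hz)
    have heq : f =ᶠ[𝓝 z] fun w => B w * h w :=
      (ContinuousAt.eventuallyEq_nhds_iff_eventuallyEq_nhdsNE hfa.continuousAt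
        (hBz.1.mul hhz).continuousAt).1 (eventually_nhdsNE_of_codiscreteWithin hfB hnhds)
    refine ⟨?_, ?_⟩
    · rw [heq.eq_of_nhds]
      exact mul_ne_zero hBz.2 (D.ne_zero z (ball_subset_closedBall hz))
    · have hEc : (E : Set ℂ)ᶜ ∈ 𝓝 z := E.finite_toSet.isClosed.isOpen_compl.mem_nhds hzE
      filter_upwards [heq.eventuallyEq_nhds, isOpen_ball.mem_nhds hz, hEc] with w hw hwb hwE
      have hwE' : w ∉ E := hwE
      have hBw := hBh w hwb hwE'
      have hwR : ‖w‖ ≤ R := le_of_lt (by simpa using hwb)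
      have hwc : ∀ c ∈ E, w ≠ c := fun c hc h0 => hwE' (h0 ▸ hc)
      have hwcb := ball_subset_closedBall hwb
      rw [logDeriv_apply, hw.deriv_eq, hw.eq_of_nhds, ← logDeriv_apply (fun w => B w * h w),
        logDeriv_mul w hBw.2 (D.ne_zero w hwcb) hBw.1.differentiableAt
          (D.analyticOnNhd w hwcb).differentiableAt, hB,
        logDeriv_prod (f := fun c w => canonicalFactor R c w ^ (-divisor f univ c))
          (fun c hc => zpow_ne_zero _ (hfac c hc w hwR (hwc c hc))) (fun c hc =>
          ((hfacd c w (hwc c hc)).zpow (hfac c hc w hwR (hwc c hc))).differentiableAt)]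
      congr 1
      refine Finset.sum_congr rfl fun c hc => ?_
      rw [logDeriv_fun_zpow (hfacd c w (hwc c hc)).differentiableAt,
        logDeriv_canonicalFactor (hEn c hc) hwR (hwc c hc)]
      push_cast
      ring

theorem iteratedDeriv_div_add_mul (α β : ℂ) (j : ℕ) : ∀ z : ℂ, β + α * z ≠ 0 →
    iteratedDeriv j (fun w => α / (β + α * w)) z =
      (-1) ^ j * j.factorial * (α / (β + α * z)) ^ (j + 1) := by
  induction j with
  | zero => intro z _; simp
  | succ j ih =>
    intro z hz
    have hev : iteratedDeriv j (fun w => α / (β + α * w)) =ᶠ[𝓝 z]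
        fun w => (-1) ^ j * j.factorial * (α / (β + α * w)) ^ (j + 1) := by
      have hc : ContinuousAt (fun w : ℂ => β + α * w) z := by fun_prop
      filter_upwards [hc.eventually_ne hz] with w hw using ih w hw
    rw [iteratedDeriv_succ, hev.deriv_eq]
    have d1 : HasDerivAt (fun w : ℂ => β + α * w) α z := by
      simpa using ((hasDerivAt_id z).const_mul α).const_add β
    have d2 := (((hasDerivAt_const z α).fun_div d1 hz).fun_pow (j + 1)).const_mul
      ((-1 : ℂ) ^ j * j.factorial)
    have e : (0 * (β + α * z) - α * α) / (β + α * z) ^ 2 = -(α / (β + α * z)) ^ 2 := by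
      rw [div_pow]; ring
    rw [d2.deriv, Nat.factorial_succ, e, Nat.add_sub_cancel]
    push_cast
    ring

/-- A weighted `ℓ²` norm with weights in `ℕ` dominates the `ℓ^(j + 2)` norms: a nonzero weight is at
least `1`, so each term with a nonzero weight is at most `s`. -/
theorem sum_mul_pow_le {ι : Type*} (E : Finset ι) (m : ι → ℕ) (x : ι → ℝ) (hx : ∀ c ∈ E, 0 ≤ x c)
    {s : ℝ} (hs : 0 ≤ s) (h : ∑ c ∈ E, m c * x c ^ 2 ≤ s ^ 2) (j : ℕ) :
    ∑ c ∈ E, m c * x c ^ (j + 2) ≤ s ^ (j + 2) := by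
  have hle : ∀ c ∈ E, m c * x c ^ (j + 2) ≤ s ^ j * (m c * x c ^ 2) := by
    intro c hc
    rcases Nat.eq_zero_or_pos (m c) with h0 | h0
    · simp [h0]
    have h1 : (1 : ℝ) ≤ m c := by exact_mod_cast h0
    have h2 : m c * x c ^ 2 ≤ s ^ 2 := (Finset.single_le_sum (f := fun c => m c * x c ^ 2)
      (fun d _ => by positivity) hc).trans h
    have h3 : x c ≤ s := by
      apply le_of_sq_le_sq _ hs
      nlinarith [sq_nonneg (x c)]
    have h4 := pow_le_pow_left₀ (hx c hc) h3 j
    calc m c * x c ^ (j + 2) = x c ^ j * (m c * x c ^ 2) := by ring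
      _ ≤ _ := by gcongr
  calc _ ≤ ∑ c ∈ E, s ^ j * (m c * x c ^ 2) := Finset.sum_le_sum hle
    _ = s ^ j * ∑ c ∈ E, m c * x c ^ 2 := by rw [Finset.mul_sum]
    _ ≤ s ^ j * s ^ 2 := by gcongr
    _ = _ := by ring

/-- Higher derivatives of the polar part of the logarithmic derivative are controlled by its square
function, since the `ℓ²` norm dominates the `ℓʲ` norms with `j ≥ 2`. -/
theorem norm_iteratedDeriv_sum_le (E : Finset ℂ) (ν : ℂ → ℤ) {R s : ℝ} {z : ℂ} (hz : ‖z‖ < R)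
    (hE : ∀ c ∈ E, ‖c‖ < R) (hzE : z ∉ E) (hs : 0 ≤ s)
    (h : ∑ c ∈ E, ((ν c).natAbs : ℝ) *
      (‖1 / (z - c)‖ ^ 2 + ‖conj c / (R ^ 2 - conj c * z)‖ ^ 2) ≤ s ^ 2) (j : ℕ) :
    ContDiffAt ℂ (j + 1) (fun w => ∑ c ∈ E, (ν c : ℂ) *
      (1 / (w - c) + conj c / (R ^ 2 - conj c * w))) z ∧
    ‖iteratedDeriv (j + 1) (fun w => ∑ c ∈ E, (ν c : ℂ) *
      (1 / (w - c) + conj c / (R ^ 2 - conj c * w))) z‖ ≤ (j + 1).factorial * s ^ (j + 2) := by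
  have hne : ∀ c ∈ E, z - c ≠ 0 := fun c hc => sub_ne_zero.2 fun h0 => hzE (h0 ▸ hc)
  have hne' : ∀ c ∈ E, (R : ℂ) ^ 2 - conj c * z ≠ 0 := fun c hc =>
    sq_sub_conj_mul_ne_zero (hE c hc) hz.le
  have c1 : ∀ c ∈ E, AnalyticAt ℂ (fun w : ℂ => 1 / (w - c)) z := fun c hc => by
    have := hne c hc
    fun_prop (disch := exact this)
  have c2 : ∀ c ∈ E, AnalyticAt ℂ (fun w : ℂ => conj c / ((R : ℂ) ^ 2 - conj c * w)) z :=
    fun c hc => by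
      have := hne' c hc
      fun_prop (disch := exact this)
  have c3 : ∀ c ∈ E, AnalyticAt ℂ (fun w : ℂ => (ν c : ℂ) *
      (1 / (w - c) + conj c / ((R : ℂ) ^ 2 - conj c * w))) z := fun c hc =>
    analyticAt_const.mul ((c1 c hc).add (c2 c hc))
  refine ⟨(Finset.analyticAt_fun_sum E c3).contDiffAt, ?_⟩
  rw [iteratedDeriv_fun_sum fun c hc => (c3 c hc).contDiffAt]
  have hterm : ∀ c ∈ E, ‖iteratedDeriv (j + 1) (fun w : ℂ => (ν c : ℂ) *
      (1 / (w - c) + conj c / ((R : ℂ) ^ 2 - conj c * w))) z‖ ≤ (j + 1).factorial *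
        (((ν c).natAbs : ℝ) * ‖1 / (z - c)‖ ^ (j + 2) +
          ((ν c).natAbs : ℝ) * ‖conj c / (R ^ 2 - conj c * z)‖ ^ (j + 2)) := by
    intro c hc
    have e1 : iteratedDeriv (j + 1) (fun w : ℂ => 1 / (w - c)) z =
        (-1) ^ (j + 1) * (j + 1).factorial * (1 / (z - c)) ^ (j + 2) := by
      have := iteratedDeriv_div_add_mul 1 (-c) (j + 1) z (by
        rw [one_mul, neg_add_eq_sub]; exact hne c hc)
      simpa only [one_mul, neg_add_eq_sub] using this
    have e2 : iteratedDeriv (j + 1) (fun w : ℂ => conj c / ((R : ℂ) ^ 2 - conj c * w)) z =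
        -((-1) ^ (j + 1) * (j + 1).factorial * (-conj c / (R ^ 2 - conj c * z)) ^ (j + 2)) := by
      have := iteratedDeriv_div_add_mul (-conj c) ((R : ℂ) ^ 2) (j + 1) z (by
        rw [neg_mul, ← sub_eq_add_neg]; exact hne' c hc)
      simp only [neg_mul, ← sub_eq_add_neg] at this
      rw [← this, ← iteratedDeriv_fun_neg]
      congr 1
      ext w
      ring
    rw [iteratedDeriv_const_mul_field, iteratedDeriv_fun_add (c1 c hc).contDiffAt
      (c2 c hc).contDiffAt, e1, e2, norm_mul, Complex.norm_intCast, ← Int.cast_abs,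
      Int.abs_eq_natAbs, Int.cast_natCast]
    have h1 : ‖(-1 : ℂ) ^ (j + 1) * (j + 1).factorial * (1 / (z - c)) ^ (j + 2)‖ =
        (j + 1).factorial * ‖1 / (z - c)‖ ^ (j + 2) := by
      rw [norm_mul, norm_mul, norm_pow, norm_pow, norm_neg, norm_one, one_pow, one_mul,
        Complex.norm_natCast]
    have h2 : ‖-((-1 : ℂ) ^ (j + 1) * (j + 1).factorial *
        (-conj c / (R ^ 2 - conj c * z)) ^ (j + 2))‖ =
        (j + 1).factorial * ‖conj c / (R ^ 2 - conj c * z)‖ ^ (j + 2) := by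
      rw [norm_neg, norm_mul, norm_mul, norm_pow, norm_pow, norm_neg, norm_one, one_pow, one_mul,
        Complex.norm_natCast, neg_div, norm_neg]
    calc _ ≤ ((ν c).natAbs : ℝ) * ((j + 1).factorial * ‖1 / (z - c)‖ ^ (j + 2) +
          (j + 1).factorial * ‖conj c / (R ^ 2 - conj c * z)‖ ^ (j + 2)) := by
          gcongr
          exact (norm_add_le _ _).trans_eq (by rw [h1, h2])
      _ = _ := by ring
  refine (norm_sum_le _ _).trans ((Finset.sum_le_sum hterm).trans ?_)
  rw [← Finset.mul_sum]
  gcongr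
  -- Both kinds of terms are handled at once, as a sum over `E` and a second copy of `E`.
  have := sum_mul_pow_le (E.disjSum E) (fun i => (ν (Sum.elim id id i)).natAbs)
    (Sum.elim (fun c => ‖1 / (z - c)‖) (fun c => ‖conj c / (R ^ 2 - conj c * z)‖))
    (by rintro (c | c) _ <;> simp only [Sum.elim_inl, Sum.elim_inr] <;> positivity) hs ?_ j
  · simpa [Finset.sum_disjSum, Finset.sum_add_distrib] using this
  · refine le_trans (le_of_eq ?_) h
    simp [Finset.sum_disjSum, Finset.sum_add_distrib, mul_add]

/-! ### Bounds from the First Main Theorem -/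

theorem meromorphicOrderAt_sub_const_ne_top {f : ℂ → ℂ} (hf : IsTranscendentalMeromorphic f)
    (a : ℂ) (z : ℂ) : meromorphicOrderAt (fun w => f w - a) z ≠ ⊤ := by
  have hm : Meromorphic fun w => f w - a := fun x => (hf.1 x).sub (MeromorphicAt.const a x)
  refine (hm.exists_meromorphicOrderAt_ne_top_iff_forall).1 ?_ z
  by_contra! hall
  refine hf.2 ⟨Polynomial.C a, 1, one_ne_zero, ?_⟩
  refine mem_codiscreteWithin_iff_forall_mem_nhdsNE.2 fun x _ => ?_
  filter_upwards [meromorphicOrderAt_eq_top_iff.1 (hall x)] with w hw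
  left
  simpa using sub_eq_zero.1 hw

theorem meromorphicOrderAt_ne_top {f : ℂ → ℂ} (hf : IsTranscendentalMeromorphic f)
    (z : ℂ) : meromorphicOrderAt f z ≠ ⊤ := by
  simpa using meromorphicOrderAt_sub_const_ne_top hf 0 z

theorem logCounting_le_characteristic {f : ℂ → ℂ} {a : WithTop ℂ} (r : ℝ) :
    logCounting f a r ≤ characteristic f a r :=
  le_add_of_nonneg_left (proximity_nonneg r)

theorem proximity_le_characteristic {f : ℂ → ℂ} {a : WithTop ℂ} {r : ℝ} (hr : 1 ≤ r) :
    proximity f a r ≤ characteristic f a r :=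
  le_add_of_nonneg_right (logCounting_nonneg hr)

theorem characteristic_inv_top {f : ℂ → ℂ} : characteristic f⁻¹ ⊤ = characteristic f 0 := by
  simp [characteristic, proximity_inv, logCounting_inv]

/-- The characteristic function of a nonconstant function is unbounded: otherwise `f` would have no
poles and would omit its own value at the origin. -/
theorem tendsto_characteristic_atTop {f : ℂ → ℂ} (hf : IsTranscendentalMeromorphic f) :
    Tendsto (characteristic f ⊤) atTop atTop := by
  have hmono := characteristic_monotoneOn hf.1
  by_contra hcon
  obtain ⟨M, hM⟩ : ∃ M, ∀ r, 1 ≤ r → characteristic f ⊤ r ≤ M := by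
    by_contra! h
    refine hcon (tendsto_atTop.2 fun M => ?_)
    obtain ⟨r, hr1, hr⟩ := h M
    filter_upwards [eventually_ge_atTop r] with s hs
    exact hr.le.trans (hmono (mem_Ioi.2 (by linarith)) (mem_Ioi.2 (by linarith)) hs)
  have hbdd : ∀ {D : Function.locallyFinsupp ℂ ℤ} (K : ℝ), 0 ≤ D →
      (∀ r, 1 ≤ r → D.logCounting r ≤ K) → D = 0 := by
    intro D K hD h
    rw [Function.locallyFinsuppWithin.zero_iff_logCounting_bounded hD]
    refine Asymptotics.IsBigO.of_bound K ?_
    filter_upwards [eventually_ge_atTop 1] with r hr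
    have h0 := Function.locallyFinsuppWithin.logCounting_nonneg hD hr
    simpa [abs_of_nonneg h0] using h r hr
  -- `N(r, f)` is bounded, so `f` has no poles and tends to some `a` at the origin. Then `f - a`
  -- has a zero there, although `N(r, 1 / (f - a))` is bounded too.
  have hneg : (divisor f univ)⁻ = 0 := by
    refine hbdd M (negPart_nonneg _) fun r hr => ?_
    rw [← logCounting_top]
    exact (logCounting_le_characteristic r).trans (hM r hr)
  have hord : 0 ≤ meromorphicOrderAt f 0 := by
    have h1 : 0 ≤ divisor f univ 0 := by
      have := (negPart_eq_zero.1 hneg)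
      exact this 0
    rw [divisor_apply hf.1.meromorphicOn (mem_univ _)] at h1
    lift meromorphicOrderAt f 0 to ℤ using meromorphicOrderAt_ne_top hf 0 with n
    exact_mod_cast h1
  obtain ⟨a, ha⟩ := tendsto_nhds_of_meromorphicOrderAt_nonneg (hf.1 0) hord
  set g : ℂ → ℂ := fun w => f w - a with hg
  have hgm : Meromorphic g := fun x => (hf.1 x).sub (MeromorphicAt.const a x)
  have hg0 : 0 < meromorphicOrderAt g 0 := by
    rw [← tendsto_zero_iff_meromorphicOrderAt_pos (hgm 0)]
    simpa using ha.sub_const a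
  have hgpos : (divisor g univ)⁺ = 0 := by
    refine hbdd (M + (log⁺ ‖a‖ + Real.log 2) + |Real.log ‖meromorphicTrailingCoeffAt g 0‖|)
      (posPart_nonneg _) fun r hr => ?_
    rw [← logCounting_zero]
    have h1 := logCounting_le_characteristic (f := g) (a := 0) r
    rw [← characteristic_inv_top] at h1
    have h2 := characteristic_sub_characteristic_inv_of_ne_zero hgm (R := r) (by linarith)
    have h3 := abs_characteristic_sub_characteristic_shift_le (a₀ := a) (r := r) hf.1
    have h4 := abs_le.1 h3
    have h5 := neg_abs_le (Real.log ‖meromorphicTrailingCoeffAt g 0‖)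
    have h6 := hM r hr
    linarith [h4.1]
  have h1 : divisor g univ 0 ≤ 0 := (posPart_eq_zero.1 hgpos) 0
  rw [divisor_apply hgm.meromorphicOn (mem_univ _)] at h1
  have h2 := meromorphicOrderAt_sub_const_ne_top hf a 0
  change meromorphicOrderAt g 0 ≠ ⊤ at h2
  lift meromorphicOrderAt g 0 to ℤ using h2 with n
  have h3 : n ≤ 0 := h1
  have h4 : 0 < n := by exact_mod_cast hg0
  omega

/-- The zeros and poles in the disc of radius `R` each contribute at least `log (ρ / R)` to the
counting functions at `ρ`. -/
theorem sum_natAbs_divisor_mul_log_le {f : ℂ → ℂ} {E : Finset ℂ} {R ρ : ℝ} (hR : 1 ≤ R)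
    (hRρ : R < ρ) (hE : ∀ c ∈ E, ‖c‖ < R) :
    (∑ c ∈ E, ((divisor f univ c).natAbs : ℝ)) * Real.log (ρ / R) ≤
      logCounting f 0 ρ + logCounting f ⊤ ρ := by
  classical
  set D : Function.locallyFinsupp ℂ ℤ := (divisor f univ)⁺ + (divisor f univ)⁻ with hD
  have hDc : ∀ c, D c = (divisor f univ c).natAbs := by
    intro c
    rw [hD, Function.locallyFinsuppWithin.coe_add, Pi.add_apply, Int.natCast_natAbs]
    exact posPart_add_negPart (divisor f univ c)
  set D' : Function.locallyFinsupp ℂ ℤ :=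
    ∑ c ∈ E, Function.locallyFinsuppWithin.single c (D c) with hD'
  have hle : D' ≤ D := by
    rw [Function.locallyFinsuppWithin.le_def, Pi.le_def]
    intro w
    simp only [hD', Function.locallyFinsuppWithin.coe_sum, Finset.sum_apply,
      Function.locallyFinsuppWithin.single_apply]
    by_cases hw : w ∈ E
    · rw [Finset.sum_eq_single w (fun c _ hc => by simp [hc.symm]) (fun h => absurd hw h)]
      simp
    · rw [Finset.sum_eq_zero fun c hc => if_neg (fun h => hw (by rw [h]; exact hc))]
      rw [hDc]
      positivity
  have h1 := Function.locallyFinsuppWithin.logCounting_le hle (r := ρ) (by linarith)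
  rw [hD, map_add, Pi.add_apply, ← logCounting_zero, ← logCounting_top] at h1
  refine le_trans ?_ h1
  rw [hD', map_sum, Finset.sum_apply, Finset.sum_mul]
  refine Finset.sum_le_sum fun c hc => ?_
  have hcR := hE c hc
  rw [Function.locallyFinsuppWithin.logCounting_single_eq_log_sub_const (by linarith), hDc,
    Real.log_div (by linarith) (by linarith)]
  have h2 : Real.log ‖c‖ ≤ Real.log R := by
    rcases eq_or_lt_of_le (norm_nonneg c) with h0 | h0
    · rw [← h0, Real.log_zero]; exact Real.log_nonneg hR
    · exact Real.log_le_log h0 hcR.le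
  rw [Int.cast_natCast]
  gcongr

theorem circleAverage_abs_log_norm {f : ℂ → ℂ} (hf : Meromorphic f) (R : ℝ) :
    circleAverage (fun z => |Real.log ‖f z‖|) 0 R = proximity f ⊤ R + proximity f 0 R := by
  rw [proximity_top, proximity_zero_of_complexValued, ← circleAverage_fun_add
    hf.meromorphicOn.circleIntegrable_posLog_norm hf.inv.meromorphicOn.circleIntegrable_posLog_norm]
  congr 1
  ext z
  rw [Pi.inv_apply, norm_inv, posLog_apply, posLog_apply, Real.log_inv]
  rcases le_total 0 (Real.log ‖f z‖) with h | h
  · rw [abs_of_nonneg h, max_eq_right h, max_eq_left (by linarith), add_zero]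
  · rw [abs_of_nonpos h, max_eq_left h, max_eq_right (by linarith), zero_add]

/-- The bounds on `m(R, f) + m(R, 1/f)` and `N(ρ, f) + N(ρ, 1/f)` from the First Main Theorem. -/
theorem exists_proximity_logCounting_le {f : ℂ → ℂ} (hf : IsTranscendentalMeromorphic f) (K : ℝ) :
    ∃ r₀ : ℝ, 1 ≤ r₀ ∧ ∀ R ρ : ℝ, r₀ ≤ R → R ≤ ρ → K ≤ characteristic f ⊤ ρ ∧
      proximity f ⊤ R + proximity f 0 R ≤ 2.2 * characteristic f ⊤ ρ ∧
      logCounting f 0 ρ + logCounting f ⊤ ρ ≤ 2.2 * characteristic f ⊤ ρ := by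
  set C := |Real.log ‖meromorphicTrailingCoeffAt f 0‖| with hC
  obtain ⟨r₁, hr₁⟩ := eventually_atTop.1
    ((tendsto_characteristic_atTop hf).eventually_ge_atTop (max K (5 * C)))
  refine ⟨max 1 r₁, le_max_left _ _, fun R ρ hR hRρ => ?_⟩
  have hR1 : 1 ≤ R := (le_max_left _ _).trans hR
  have hT := hr₁ ρ (((le_max_right _ _).trans hR).trans hRρ)
  have hinv : ∀ s : ℝ, 1 ≤ s → characteristic f 0 s ≤ characteristic f ⊤ s + C := by
    intro s hs
    have h1 := characteristic_sub_characteristic_inv_of_ne_zero hf.1 (R := s) (by linarith)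
    rw [characteristic_inv_top] at h1
    have := neg_abs_le (Real.log ‖meromorphicTrailingCoeffAt f 0‖)
    linarith
  have hmono : characteristic f ⊤ R ≤ characteristic f ⊤ ρ :=
    characteristic_monotoneOn hf.1 (mem_Ioi.2 (by linarith)) (mem_Ioi.2 (by linarith)) hRρ
  have h5 : 5 * C ≤ characteristic f ⊤ ρ := (le_max_right _ _).trans hT
  refine ⟨(le_max_left _ _).trans hT, ?_, ?_⟩
  · have h1 := proximity_le_characteristic (f := f) (a := ⊤) hR1
    have h2 := proximity_le_characteristic (f := f) (a := 0) hR1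
    have h3 := hinv R hR1
    linarith
  · have h1 := logCounting_le_characteristic (f := f) (a := ⊤) ρ
    have h2 := logCounting_le_characteristic (f := f) (a := 0) ρ
    have h3 := hinv ρ (hR1.trans hRρ)
    linarith

/-! ### The lemma on the logarithmic derivative -/

/-- Some circle with radius in a given interval carries no zeros or poles. -/
theorem exists_radius_forall_meromorphicOrderAt_eq_zero {f : ℂ → ℂ} (hf : Meromorphic f)
    (hft : ∀ z, meromorphicOrderAt f z ≠ ⊤) {a b : ℝ} (hab : a < b) :
    ∃ R ∈ Ioo a b, ∀ z ∈ sphere (0 : ℂ) R, meromorphicOrderAt f z = 0 := by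
  have hfin : (divisor f (closedBall 0 b)).support.Finite :=
    (divisor f (closedBall 0 b)).finiteSupport (isCompact_closedBall 0 b)
  obtain ⟨R, hR, hRn⟩ := ((Ioo_infinite hab).sdiff (hfin.image norm)).nonempty
  refine ⟨R, hR, fun z hz => ?_⟩
  have hzR : ‖z‖ = R := by simpa using hz
  have hzb : z ∈ closedBall (0 : ℂ) b := by simpa [hzR] using hR.2.le
  have h0 : divisor f (closedBall 0 b) z = 0 := by
    by_contra h
    exact hRn ⟨z, h, hzR⟩
  rw [divisor_apply hf.meromorphicOn hzb] at h0
  have := hft z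
  lift meromorphicOrderAt f z to ℤ using this with n
  have : n = 0 := h0
  simp [this]

/-- The bounds for the zero-free part and for the polar part of a logarithmic derivative combine to
a geometric bound. -/
theorem two_mul_pow_add_pow_le {A b s : ℝ} (hA : 0 ≤ A) (hb : 0 ≤ b) (hs : 0 ≤ s) (j : ℕ) :
    2 * A * b ^ (j + 1) + s ^ (j + 2) ≤ (A + b + s) ^ (j + 2) := by
  have h1 : 2 * A * b ^ (j + 1) ≤ (A + b) ^ (j + 2) := by
    have h2 : b ^ j ≤ (A + b) ^ j := pow_le_pow_left₀ hb (by linarith) j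
    calc 2 * A * b ^ (j + 1) = b ^ j * (2 * A * b) := by ring
      _ ≤ (A + b) ^ j * (A + b) ^ 2 := by
        gcongr
        nlinarith [sq_nonneg A, sq_nonneg b]
      _ = _ := by ring
  have h3 : (A + b) ^ (j + 1) ≤ (A + b + s) ^ (j + 1) :=
    pow_le_pow_left₀ (by positivity) (by linarith) _
  have h4 : s ^ (j + 1) ≤ (A + b + s) ^ (j + 1) := pow_le_pow_left₀ hs (by linarith) _
  calc _ ≤ (A + b) ^ (j + 1) * (A + b) + s ^ (j + 1) * s := by
        rw [← pow_succ, ← pow_succ]; linarith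
    _ ≤ (A + b + s) ^ (j + 1) * (A + b) + (A + b + s) ^ (j + 1) * s := by gcongr
    _ = _ := by ring

/-- At a regular point of the disc, the derivatives of `f` are dominated geometrically. The number
`A` bounds the zero-free part of `f' / f`, while `p` and `s` bound the polar part and its square
function. -/
theorem norm_iteratedDeriv_le_of_logDeriv_eq {f h : ℂ → ℂ} {E : Finset ℂ} {ν : ℂ → ℤ} {R : ℝ}
    {z : ℂ} {A b p s X : ℝ} (hz : ‖z‖ < R) (hE : ∀ c ∈ E, ‖c‖ < R) (hzE : z ∉ E)
    (hfa : AnalyticAt ℂ f z) (hfz : f z ≠ 0) (hh : AnalyticAt ℂ (logDeriv h) z)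
    (heq : logDeriv f =ᶠ[𝓝 z] fun w => (∑ c ∈ E, (ν c : ℂ) *
      (1 / (w - c) + conj c / (R ^ 2 - conj c * w))) + logDeriv h w)
    (hA : 0 ≤ A) (hb : 0 ≤ b) (hs : 0 ≤ s)
    (hp : ‖∑ c ∈ E, (ν c : ℂ) * (1 / (z - c) + conj c / (R ^ 2 - conj c * z))‖ ≤ p)
    (hsq : ∑ c ∈ E, ((ν c).natAbs : ℝ) *
      (‖1 / (z - c)‖ ^ 2 + ‖conj c / (R ^ 2 - conj c * z)‖ ^ 2) ≤ s ^ 2)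
    (hh0 : ‖logDeriv h z‖ ≤ A)
    (hhj : ∀ j : ℕ, ‖iteratedDeriv j (logDeriv h) z‖ ≤ j.factorial * (2 * A * b ^ j))
    (hX1 : A + p ≤ X) (hX2 : A + b + s ≤ X) (k : ℕ) :
    ‖iteratedDeriv k f z‖ ≤ k.factorial * X ^ k * ‖f z‖ := by
  refine norm_iteratedDeriv_le_of_logDeriv (by linarith) hfa hfz (fun j => ?_) k
  rw [heq.iteratedDeriv_eq]
  rcases j with _ | j
  · rw [iteratedDeriv_zero, Nat.factorial_zero, Nat.cast_one, one_mul, zero_add, pow_one]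
    refine (norm_add_le _ _).trans ?_
    linarith
  · obtain ⟨hcd, hn⟩ := norm_iteratedDeriv_sum_le E ν hz hE hzE hs hsq j
    rw [iteratedDeriv_fun_add (by exact_mod_cast hcd) hh.contDiffAt]
    calc _ ≤ (j + 1).factorial * s ^ (j + 2) + (j + 1).factorial * (2 * A * b ^ (j + 1)) :=
          (norm_add_le _ _).trans (add_le_add hn (hhj (j + 1)))
      _ = (j + 1).factorial * (2 * A * b ^ (j + 1) + s ^ (j + 2)) := by ring
      _ ≤ (j + 1).factorial * X ^ (j + 2) := by
          gcongr
          exact (two_mul_pow_add_pow_le hA hb hs j).trans (pow_le_pow_left₀ (by positivity) hX2 _)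

/-- The factor in front of the Poisson integral, for a radius `R` about half-way between `r` and
`ρ`. -/
theorem poisson_factor_le {r R ρ T : ℝ} (hr : 0 < r) (hrρ : r < ρ) (hT : 0 ≤ T)
    (h1 : r + 0.48 * (ρ - r) ≤ R) (h2 : R ≤ r + 0.5 * (ρ - r)) :
    2 * R / (R ^ 2 - r ^ 2) * (2.2 * T) ≤ 4.6 * (T / r * (ρ / (ρ - r))) := by
  have hd : 0 < ρ - r := by linarith
  have hRr : 0 < R - r := by linarith
  have hR : 0 < R := by linarith
  have hfac : R ^ 2 - r ^ 2 = (R - r) * (R + r) := by ring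
  have h3 : 2 * R / (R ^ 2 - r ^ 2) * 2.2 ≤ 4.6 * (1 / r * (ρ / (ρ - r))) := by
    rw [hfac, div_mul_eq_mul_div, div_mul_div_comm, one_mul, mul_div_assoc',
      div_le_div_iff₀ (by positivity) (by positivity)]
    have h4 : 4.4 * r ≤ 2.208 * (R + r) := by linarith
    calc 2 * R * 2.2 * (r * (ρ - r)) = (4.4 * r) * R * (ρ - r) := by ring
      _ ≤ (2.208 * (R + r)) * ρ * (ρ - r) := by gcongr; linarith
      _ = 4.6 * ρ * ((0.48 * (ρ - r)) * (R + r)) := by ring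
      _ ≤ 4.6 * ρ * ((R - r) * (R + r)) := by gcongr <;> linarith
  calc _ = T * (2 * R / (R ^ 2 - r ^ 2) * 2.2) := by ring
    _ ≤ T * (4.6 * (1 / r * (ρ / (ρ - r)))) := by gcongr
    _ = _ := by ring

/-- Number of zeros and poles in the disc of radius `R`, in terms of the counting functions at a
larger radius. -/
theorem count_le {r R ρ T n : ℝ} (hr : 0 < r) (hrρ : r < ρ) (hn : 0 ≤ n)
    (h1 : r ≤ R) (h2 : R ≤ r + 0.5 * (ρ - r)) (h : n * Real.log (ρ / R) ≤ 2.2 * T) :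
    n ≤ 4.4 * (T / r * (ρ / (ρ - r))) * r := by
  have hd : 0 < ρ - r := by linarith
  have hR : 0 < R := by linarith
  have hρ : 0 < ρ := by linarith
  have h3 : 0.5 * (ρ - r) / ρ ≤ Real.log (ρ / R) := by
    have := Real.one_sub_inv_le_log_of_pos (x := ρ / R) (by positivity)
    refine le_trans ?_ this
    rw [inv_div, one_sub_div hρ.ne']
    gcongr
    linarith
  have h4 : n * (0.5 * (ρ - r) / ρ) ≤ 2.2 * T := (mul_le_mul_of_nonneg_left h3 hn).trans h
  have h5 : 4.4 * (T / r * (ρ / (ρ - r))) * r = 2.2 * T * (ρ / (0.5 * (ρ - r))) := by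
    field_simp
    ring
  rw [h5]
  calc n = n * (0.5 * (ρ - r) / ρ) * (ρ / (0.5 * (ρ - r))) := by field_simp
    _ ≤ _ := by gcongr

set_option maxHeartbeats 800000 in
/-- **Lemma on the logarithmic derivative**, in a form that covers all derivatives at once: off a
discrete set, `|f⁽ᵏ⁾ / f| ≤ k! exp (k U)` on the circle `|z| = r`, where the mean of `U` is at most
`log⁺ (T(ρ) / r * ρ / (ρ - r)) + 5.3078`. -/
theorem exists_norm_iteratedDeriv_le_exp {f : ℂ → ℂ} (hf : IsTranscendentalMeromorphic f) :
    ∃ r₀ : ℝ, 0 < r₀ ∧ ∀ r ρ : ℝ, r₀ < r → r < ρ → ∃ U : ℂ → ℝ, CircleIntegrable U 0 r ∧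
      circleAverage U 0 r ≤ log⁺ (characteristic f ⊤ ρ / r * (ρ / (ρ - r))) + 5.3078 ∧
      ∀ᶠ z in codiscreteWithin (sphere (0 : ℂ) r), 0 ≤ U z ∧ f z ≠ 0 ∧
        ∀ k : ℕ, ‖iteratedDeriv k f z‖ ≤ k.factorial * Real.exp (U z) ^ k * ‖f z‖ := by
  obtain ⟨r₀, hr₀, hT⟩ := exists_proximity_logCounting_le hf 3
  refine ⟨r₀, by linarith, fun r ρ hr hrρ => ?_⟩
  have hr1 : 1 ≤ r := by linarith
  have hr0 : 0 < r := by linarith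
  obtain ⟨R, ⟨hR1, hR2⟩, hRS⟩ := exists_radius_forall_meromorphicOrderAt_eq_zero hf.1
    (meromorphicOrderAt_ne_top hf) (a := r + 0.48 * (ρ - r)) (b := r + 0.5 * (ρ - r)) (by linarith)
  have hrR : r < R := by linarith
  have hRρ : R < ρ := by linarith
  have hR0 : 0 < R := by linarith
  obtain ⟨hT3, hTm, hTN⟩ := hT R ρ (by linarith) hRρ.le
  set T := characteristic f ⊤ ρ with hTdef
  set L := T / r * (ρ / (ρ - r)) with hL
  have hd : 0 < ρ - r := by linarith
  have hρ0 : 0 < ρ := by linarith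
  have hL0 : 0 < L := by positivity
  obtain ⟨E, h, hE, hha, hhn, hfh, hloc⟩ :=
    exists_logDeriv_eq_sum hf.1 (meromorphicOrderAt_ne_top hf) hRS
  obtain ⟨V, hVa, hVre, hV0, hVb, hVj⟩ :=
    exists_re_nonneg_norm_iteratedDeriv_logDeriv_le hR0 hha hhn
  set ν : ℂ → ℤ := fun c => divisor f univ c with hν
  set n : ℝ := ∑ c ∈ E, ((ν c).natAbs : ℝ) with hn
  have hn0 : 0 ≤ n := by positivity
  have hnL : n ≤ 4.4 * L * r := count_le hr0 hrρ hn0 hrR.le hR2.le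
    ((sum_natAbs_divisor_mul_log_le (by linarith) hRρ hE).trans hTN)
  have hVM : (V 0).re ≤ 2.2 * T := by
    rw [hV0]
    refine le_trans (le_of_eq ?_) hTm
    rw [← circleAverage_abs_log_norm hf.1]
    refine (circleAverage_congr_codiscreteWithin ?_ hR0.ne').symm
    rw [abs_of_pos hR0]
    filter_upwards [hfh] with z hz
    simp only [hz]
  -- The weights `12 L`, `48 L`, `48 L` and `4 L` add up to less than `64 L`, while the logarithmic
  -- means of the normalized terms add up to less than `1`.
  obtain ⟨U₁, hU₁i, hU₁a, hU₁⟩ :=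
    exists_circleIntegrable_norm_sum_le E ν hr0 hrR (t := 1 / (12 * L * r)) (by positivity) hE
  obtain ⟨U₂, hU₂i, hU₂a, hU₂⟩ := exists_circleIntegrable_squareSum_le E (fun c => (ν c).natAbs)
    hr0 hrR (η := 1 / (48 * L * r)) (by positivity) hE
  set q : ℝ := 2 * R / (R ^ 2 - r ^ 2) with hq
  have hRr2 : 0 < R ^ 2 - r ^ 2 := by nlinarith
  have hq0 : 0 ≤ q := by positivity
  set U₃ : ℂ → ℝ := fun z => (q / (12 * L)) • (V z).re with hU₃
  have hVi : CircleIntegrable (fun z => (V z).re) 0 r := by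
    apply ContinuousOn.circleIntegrable hr0.le
    intro z hz
    have hzR : z ∈ ball (0 : ℂ) R := by
      have : ‖z‖ = r := by simpa using hz
      simpa [this] using hrR
    exact (Complex.continuous_re.continuousAt.comp (hVa z hzR).continuousAt).continuousWithinAt
  have hU₃i : CircleIntegrable U₃ 0 r := hVi.const_smul
  have hU₃a : circleAverage U₃ 0 r ≤ 0.4 := by
    have hmean : circleAverage (fun z => (V z).re) 0 r = (V 0).re := by
      apply InnerProductSpace.HarmonicOnNhd.circleAverage_eq (f := fun z => (V z).re)
      intro z hz
      rw [abs_of_pos hr0] at hz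
      exact (hVa z (closedBall_subset_ball hrR hz)).harmonicAt_re
    rw [hU₃, circleAverage_fun_smul, hmean, smul_eq_mul]
    have h1 := poisson_factor_le hr0 hrρ (T := T) (by linarith) hR1.le hR2.le
    have h2 : q * (V 0).re ≤ 4.6 * L := (mul_le_mul_of_nonneg_left hVM hq0).trans h1
    rw [div_mul_eq_mul_div, div_le_iff₀ (by positivity)]
    linarith
  have hU₁a' : circleAverage U₁ 0 r ≤ 0.37 := by
    refine hU₁a.trans ?_
    rw [one_div_mul_eq_div, div_le_iff₀ (by positivity)]
    have : 0 < L * r := by positivity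
    linarith
  have hU₂a' : circleAverage U₂ 0 r ≤ 0.19 := by
    refine hU₂a.trans ?_
    rw [mul_one_div, div_mul_eq_mul_div, div_le_iff₀ (by positivity)]
    have : 0 < L * r := by positivity
    linarith
  refine ⟨(fun _ => Real.log 64 + log⁺ L) + (U₁ + (U₂ + U₃)), ?_, ?_, ?_⟩
  · exact (circleIntegrable_const _ _ _).add (hU₁i.add (hU₂i.add hU₃i))
  · rw [circleAverage_add (circleIntegrable_const _ _ _) (hU₁i.add (hU₂i.add hU₃i)),
      circleAverage_add hU₁i (hU₂i.add hU₃i), circleAverage_add hU₂i hU₃i,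
      circleAverage_const]
    have hlog : Real.log 64 ≤ 4.2 := by
      rw [show (64 : ℝ) = 2 ^ 6 by norm_num, Real.log_pow]
      have := Real.log_two_lt_d9
      push_cast
      linarith
    linarith
  · have hana := (hf.1.meromorphicOn (s := sphere (0 : ℂ) r)).analyticAt_mem_codiscreteWithin
    have hEc : (E : Set ℂ)ᶜ ∈ codiscreteWithin (sphere (0 : ℂ) r) :=
      codiscreteWithin_mono (subset_univ _) E.finite_toSet.compl_mem_codiscrete
    filter_upwards [hana, hEc, self_mem_codiscreteWithin (sphere (0 : ℂ) r)] with z hza hzE hzS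
    have hzE' : z ∉ E := hzE
    have hzr : ‖z‖ = r := by simpa using hzS
    have hzR : ‖z‖ < R := by linarith
    have hzb : z ∈ ball (0 : ℂ) R := by simpa using hzR
    have hzcb := ball_subset_closedBall hzb
    obtain ⟨hfz, heq⟩ := hloc z hzb hzE' hza
    obtain ⟨hu1, hp⟩ := hU₁ z hzS
    obtain ⟨hu2, hs⟩ := hU₂ z hzS
    have hu3 : 0 ≤ U₃ z := by
      have := hVre z hzb
      simp only [hU₃, smul_eq_mul]
      positivity
    have hlogL : 0 ≤ Real.log 64 := Real.log_nonneg (by norm_num)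
    have hposL : 0 ≤ log⁺ L := posLog_nonneg
    simp only [Pi.add_apply]
    refine ⟨by positivity, hfz, ?_⟩
    set W := U₁ z + (U₂ z + U₃ z) with hW
    have hX : 64 * L * Real.exp W ≤ Real.exp (Real.log 64 + log⁺ L + W) := by
      rw [Real.exp_add _ W, Real.exp_add (Real.log 64), Real.exp_log (by norm_num)]
      gcongr
      rw [← Real.log_le_iff_le_exp hL0]
      exact le_max_right _ _
    have e1 : Real.exp (U₁ z) ≤ Real.exp W := Real.exp_le_exp.2 (by linarith)
    have e2 : Real.exp (U₂ z) ≤ Real.exp W := Real.exp_le_exp.2 (by linarith)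
    have e3 : U₃ z ≤ Real.exp W :=
      (by linarith [Real.add_one_le_exp (U₃ z)] : U₃ z ≤ Real.exp (U₃ z)).trans
        (Real.exp_le_exp.2 (by linarith))
    have e0 : 1 ≤ Real.exp W := Real.one_le_exp (by positivity)
    have hA : q * (V z).re = 12 * L * U₃ z := by
      simp only [hU₃, smul_eq_mul]
      field_simp
    have hb : 4 / (R - r) ≤ 4 * L := by
      have h1 : 3 / (ρ - r) ≤ L := by
        rw [hL, div_mul_div_comm, div_le_div_iff₀ hd (by positivity)]
        have : r * 3 ≤ ρ * T := by gcongr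
        nlinarith
      have h2 : 1 / (R - r) ≤ 1 / (0.48 * (ρ - r)) := by gcongr; linarith
      have h3 : 1 / (0.48 * (ρ - r)) ≤ 3 / (ρ - r) := by
        rw [div_le_div_iff₀ (by positivity) hd]
        linarith
      calc 4 / (R - r) = 4 * (1 / (R - r)) := by ring
        _ ≤ _ := by linarith
    have hp' := hp hzE'
    have hs' := hs hzE'
    have hRr : 0 < R - r := by linarith
    have hA12 : q * (V z).re ≤ 12 * L * Real.exp W := by rw [hA]; gcongr
    refine norm_iteratedDeriv_le_of_logDeriv_eq (A := q * (V z).re) (b := 4 / (R - r))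
      (p := 48 * L * Real.exp (U₁ z)) (s := 48 * L * Real.exp (U₂ z)) hzR hE hzE' hza hfz
      ((hha z hzcb).deriv.div (hha z hzcb) (hhn z hzcb)) heq ?_ (by positivity) (by positivity)
      ?_ ?_ ?_ ?_ ?_ ?_
    · have := hVre z hzb
      positivity
    · have : 1 / (12 * L * r) * r = 1 / (12 * L) := by field_simp
      rw [this, one_div_mul_eq_div, div_le_iff₀ (by positivity)] at hp'
      linarith
    · have : 1 / (48 * L * r) * r = 1 / (48 * L) := by field_simp
      rw [this, div_pow, one_pow, one_div_mul_eq_div, div_le_iff₀ (by positivity)] at hs'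
      rw [mul_pow]
      linarith
    · simpa [hzr] using hVb z hzb
    · simpa [hzr] using hVj z hzb
    · refine le_trans ?_ hX
      have : 48 * L * Real.exp (U₁ z) ≤ 48 * L * Real.exp W := by gcongr
      have : 0 ≤ L * Real.exp W := by positivity
      linarith
    · refine le_trans ?_ hX
      have h1 : 48 * L * Real.exp (U₂ z) ≤ 48 * L * Real.exp W := by gcongr
      have h2 : 4 * L ≤ 4 * L * Real.exp W := le_mul_of_one_le_right (by positivity) e0
      linarith

/-! ### Clunie's argument -/

theorem Meromorphic.diffPoly {m : ℕ} {I : Finset (Fin (m + 1) → ℕ)}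
    {a : (Fin (m + 1) → ℕ) → ℂ → ℂ} {f : ℂ → ℂ} (ha : ∀ l ∈ I, Meromorphic (a l))
    (hf : Meromorphic f) : Meromorphic (diffPoly I a f) := by
  have hd : ∀ k, Meromorphic (iteratedDeriv k f) := fun k => by
    induction k with
    | zero => simpa using hf
    | succ k ih => rw [iteratedDeriv_succ]; exact ih.deriv
  exact Meromorphic.fun_sum fun l hl =>
    (ha l hl).mul (Meromorphic.fun_prod fun j _ => (hd j).fun_pow)

theorem norm_diffMonomial_le {m : ℕ} (l : Fin (m + 1) → ℕ) {f : ℂ → ℂ} {z : ℂ} {u : ℝ}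
    (h : ∀ k : ℕ, ‖iteratedDeriv k f z‖ ≤ k.factorial * Real.exp u ^ k * ‖f z‖) :
    ‖diffMonomial l f z‖ ≤
      (m.factorial : ℝ) ^ multiDegree l * Real.exp u ^ multiWeight l * ‖f z‖ ^ multiDegree l := by
  rw [diffMonomial, norm_prod]
  calc ∏ j : Fin (m + 1), ‖iteratedDeriv (j : ℕ) f z ^ l j‖
      ≤ ∏ j : Fin (m + 1),
          ((m.factorial : ℝ) ^ l j * Real.exp u ^ ((j : ℕ) * l j) * ‖f z‖ ^ l j) := by
        refine Finset.prod_le_prod (fun _ _ => norm_nonneg _) fun j _ => ?_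
        rw [norm_pow, pow_mul, ← mul_pow, ← mul_pow]
        refine pow_le_pow_left₀ (norm_nonneg _) ((h j).trans ?_) _
        gcongr
        exact Nat.lt_succ_iff.1 j.2
    _ = _ := by
        rw [Finset.prod_mul_distrib, Finset.prod_mul_distrib, Finset.prod_pow_eq_pow_sum,
          Finset.prod_pow_eq_pow_sum, Finset.prod_pow_eq_pow_sum, multiDegree, multiWeight]

/-- A pointwise bound for a differential polynomial divided by a number `c` that dominates all the
powers of `f z` in its terms. Clunie's argument takes `c = 1` where `|f| ≤ 1`, and `c = f z ^ n`
where `|f| ≥ 1`. -/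
theorem posLog_norm_diffPoly_div_le {m : ℕ} (I : Finset (Fin (m + 1) → ℕ))
    (a : (Fin (m + 1) → ℕ) → ℂ → ℂ) {f : ℂ → ℂ} {z c : ℂ} {u : ℝ} (hu : 0 ≤ u)
    (h : ∀ k : ℕ, ‖iteratedDeriv k f z‖ ≤ k.factorial * Real.exp u ^ k * ‖f z‖)
    (hc : c ≠ 0) (hfc : ∀ l ∈ I, ‖f z‖ ^ multiDegree l ≤ ‖c‖) :
    log⁺ ‖diffPoly I a f z / c‖ ≤ log⁺ (I.card : ℝ) + ∑ l ∈ I, log⁺ ‖a l z‖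
      + (∑ l ∈ I, (multiDegree l : ℝ)) * Real.log (m.factorial : ℝ)
      + (∑ l ∈ I, (multiWeight l : ℝ)) * u := by
  have hm : (1 : ℝ) ≤ m.factorial := by exact_mod_cast m.factorial_pos
  rw [diffPoly, Finset.sum_div, log_of_nat_eq_posLog, Finset.sum_mul, Finset.sum_mul, add_assoc,
    add_assoc, ← Finset.sum_add_distrib, ← Finset.sum_add_distrib]
  refine (posLog_norm_sum_le I _).trans (add_le_add_right (Finset.sum_le_sum fun l hl => ?_) _)
  have hterm : ‖a l z * diffMonomial l f z / c‖ ≤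
      ‖a l z‖ * ((m.factorial : ℝ) ^ multiDegree l * Real.exp u ^ multiWeight l) := by
    rw [norm_div, norm_mul, mul_div_assoc]
    gcongr
    rw [div_le_iff₀ (norm_pos_iff.2 hc)]
    refine (norm_diffMonomial_le l h).trans ?_
    gcongr
    exact hfc l hl
  have hone : 1 ≤ (m.factorial : ℝ) ^ multiDegree l * Real.exp u ^ multiWeight l :=
    one_le_mul_of_one_le_of_one_le (one_le_pow₀ hm) (one_le_pow₀ (Real.one_le_exp hu))
  refine (posLog_le_posLog (norm_nonneg _) hterm).trans (posLog_mul.trans ?_)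
  rw [posLog_eq_log (hone.trans (le_abs_self _)), Real.log_mul (by positivity)
    (by positivity), Real.log_pow, Real.log_pow, Real.log_exp]

/-- Clunie's argument: where `|f| ≤ 1` the differential polynomial `P` is estimated directly, and
where `|f| ≥ 1` it is `Q / f ^ n`, with `Q` of total degree at most `n`. -/
theorem posLog_norm_diffPoly_le {n m k : ℕ} {I : Finset (Fin (m + 1) → ℕ)}
    {a : (Fin (m + 1) → ℕ) → ℂ → ℂ} {J : Finset (Fin (k + 1) → ℕ)}
    {b : (Fin (k + 1) → ℕ) → ℂ → ℂ} {f : ℂ → ℂ} {z : ℂ} {u : ℝ} (hdeg : totalDegree J ≤ n)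
    (hsol : f z ^ n * diffPoly I a f z = diffPoly J b f z) (hfz : f z ≠ 0) (hu : 0 ≤ u)
    (h : ∀ k : ℕ, ‖iteratedDeriv k f z‖ ≤ k.factorial * Real.exp u ^ k * ‖f z‖) :
    log⁺ ‖diffPoly I a f z‖ ≤
      (log⁺ (I.card : ℝ) + ∑ l ∈ I, log⁺ ‖a l z‖
        + (∑ l ∈ I, (multiDegree l : ℝ)) * Real.log (m.factorial : ℝ)
        + (∑ l ∈ I, (multiWeight l : ℝ)) * u)
      + (log⁺ (J.card : ℝ) + ∑ l ∈ J, log⁺ ‖b l z‖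
        + (∑ l ∈ J, (multiDegree l : ℝ)) * Real.log (k.factorial : ℝ)
        + (∑ l ∈ J, (multiWeight l : ℝ)) * u) := by
  have hnonneg : ∀ {i : ℕ} (K : Finset (Fin (i + 1) → ℕ)) (g : (Fin (i + 1) → ℕ) → ℂ → ℂ),
      0 ≤ log⁺ (K.card : ℝ) + ∑ l ∈ K, log⁺ ‖g l z‖
        + (∑ l ∈ K, (multiDegree l : ℝ)) * Real.log (i.factorial : ℝ)
        + (∑ l ∈ K, (multiWeight l : ℝ)) * u := fun {i} K g => by
    have h1 : 0 ≤ ∑ l ∈ K, log⁺ ‖g l z‖ := Finset.sum_nonneg fun _ _ => posLog_nonneg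
    have h2 : 0 ≤ log⁺ (K.card : ℝ) := posLog_nonneg
    have h3 : 0 ≤ Real.log (i.factorial : ℝ) := Real.log_natCast_nonneg _
    positivity
  rcases le_total ‖f z‖ 1 with h1 | h1
  · refine le_add_of_le_of_nonneg ?_ (hnonneg J b)
    have := posLog_norm_diffPoly_div_le I a hu h one_ne_zero fun l _ => by
      simpa using pow_le_one₀ (norm_nonneg _) h1
    rwa [div_one] at this
  · refine le_add_of_nonneg_of_le (hnonneg I a) ?_
    have := posLog_norm_diffPoly_div_le J b hu h (pow_ne_zero n hfz) fun l hl => by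
      rw [norm_pow]
      exact pow_le_pow_right₀ h1 ((Finset.le_sup (f := multiDegree) hl).trans hdeg)
    rwa [← hsol, mul_div_cancel_left₀ _ (pow_ne_zero n hfz)] at this

/-- The sum of the proximity functions is an average over the circle. -/
theorem circleAverage_sum_posLog_norm {ι : Type*} {s : Finset ι} {g : ι → ℂ → ℂ}
    (hg : ∀ i ∈ s, Meromorphic (g i)) (r : ℝ) :
    CircleIntegrable (fun z => ∑ i ∈ s, log⁺ ‖g i z‖) 0 r ∧
      circleAverage (fun z => ∑ i ∈ s, log⁺ ‖g i z‖) 0 r = ∑ i ∈ s, proximity (g i) ⊤ r := by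
  have hi : ∀ i ∈ s, CircleIntegrable (fun z => log⁺ ‖g i z‖) 0 r := fun i h =>
    (hg i h).meromorphicOn.circleIntegrable_posLog_norm
  refine ⟨CircleIntegrable.fun_sum s hi, ?_⟩
  rw [circleAverage_fun_sum hi]
  simp [proximity_top]

end

theorem theorem6p1 (f : ℂ → ℂ) (hf : IsTranscendentalMeromorphic f) (n m k : ℕ)
    (I : Finset (Fin (m + 1) → ℕ)) (a : (Fin (m + 1) → ℕ) → ℂ → ℂ)
    (ha : ∀ l ∈ I, Meromorphic (a l))
    (J : Finset (Fin (k + 1) → ℕ)) (b : (Fin (k + 1) → ℕ) → ℂ → ℂ)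
    (hb : ∀ l ∈ J, Meromorphic (b l))
    (hsol : (fun z => f z ^ n * diffPoly I a f z) =ᶠ[codiscrete ℂ] diffPoly J b f)
    (hdeg : totalDegree J ≤ n) :
    ∃ r₀ : ℝ, 0 < r₀ ∧ ∀ r ρ : ℝ, r₀ < r → r < ρ →
      proximity (diffPoly I a f) ⊤ r ≤
        ((∑ l ∈ I, (multiWeight l : ℝ)) + ∑ l ∈ J, (multiWeight l : ℝ)) *
            log⁺ (characteristic f ⊤ ρ / r * (ρ / (ρ - r)))
          + ∑ l ∈ I, proximity (a l) ⊤ r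
          + ∑ l ∈ J, proximity (b l) ⊤ r
          + (∑ l ∈ I, (multiDegree l : ℝ)) * Real.log (m.factorial : ℝ)
          + (∑ l ∈ J, (multiDegree l : ℝ)) * Real.log (k.factorial : ℝ)
          + log⁺ (I.card : ℝ) + log⁺ (J.card : ℝ)
          + ((∑ l ∈ I, (multiWeight l : ℝ)) + ∑ l ∈ J, (multiWeight l : ℝ)) * 5.3078 := by
  obtain ⟨r₀, hr₀, H⟩ := exists_norm_iteratedDeriv_le_exp hf
  refine ⟨r₀, hr₀, fun r ρ hr hrρ => ?_⟩
  obtain ⟨U, hUi, hUa, hU⟩ := H r ρ hr hrρ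
  have hr0 : 0 < r := hr₀.trans hr
  obtain ⟨hai, haa⟩ := circleAverage_sum_posLog_norm ha r
  obtain ⟨hbi, hba⟩ := circleAverage_sum_posLog_norm hb r
  set W : ℝ := (∑ l ∈ I, (multiWeight l : ℝ)) + ∑ l ∈ J, (multiWeight l : ℝ) with hW
  have hW0 : 0 ≤ W := by positivity
  set C : ℝ := (∑ l ∈ I, (multiDegree l : ℝ)) * Real.log (m.factorial : ℝ)
    + (∑ l ∈ J, (multiDegree l : ℝ)) * Real.log (k.factorial : ℝ)
    + log⁺ (I.card : ℝ) + log⁺ (J.card : ℝ) with hC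
  have hWU : CircleIntegrable (fun z => W • U z) 0 r := hUi.const_smul
  have key : circleAverage (fun z => log⁺ ‖diffPoly I a f z‖) 0 r ≤
      circleAverage ((fun z => ∑ l ∈ I, log⁺ ‖a l z‖) + ((fun z => ∑ l ∈ J, log⁺ ‖b l z‖) +
        ((fun _ => C) + fun z => W • U z))) 0 r := by
    refine circleAverage_mono_of_eventually hr0.ne'
      (Meromorphic.diffPoly ha hf.1).meromorphicOn.circleIntegrable_posLog_norm
      (hai.add (hbi.add ((circleIntegrable_const _ _ _).add hWU))) ?_
    rw [abs_of_pos hr0]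
    filter_upwards [hU, hsol.filter_mono (codiscreteWithin_mono (Set.subset_univ _))]
      with z ⟨hu, hfz, hder⟩ hz
    refine (posLog_norm_diffPoly_le hdeg hz hfz hu hder).trans (le_of_eq ?_)
    simp only [Pi.add_apply, smul_eq_mul, hW, hC]
    ring
  rw [circleAverage_add hai (hbi.add ((circleIntegrable_const _ _ _).add hWU)),
    circleAverage_add hbi ((circleIntegrable_const _ _ _).add hWU),
    circleAverage_add (circleIntegrable_const _ _ _) hWU, circleAverage_const, haa, hba,
    circleAverage_fun_smul, smul_eq_mul] at key
  rw [proximity_top]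
  have := mul_le_mul_of_nonneg_left hUa hW0
  simp only [hC] at key
  linarith
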